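/- Consider the downlink from a base station with a $Q_v\times Q_h$ uniform rectangular array ($Q=Q_hQ_v\ge1$ antennas, spacing $d>0$, carrier wavelength $\lambda>0$) to $K$ single-antenna users. Let $M,N\ge 1$, $T>0$, $\Delta f=1/T$, $E_T>0$ (energy), $N_0>0$ (noise level). User $s$ has $L_s\ge1$ channel paths; path $i$ has fixed complex gain $g_{s,i}$, mean power $\beta_{s,i}>0$, zenith and azimuth angles $\theta_{s,i},\phi_{s,i}$, Doppler shift $\nu_{s,i}$ and delay $\tau_{s,i}=l_{s,i}T/M$ with an integer $0\le l_{s,i}<M$; put $\tau_{\max}=\max_{s,i}\tau_{s,i}$. Denote all these fixed parameters by $\mathcal P$. For $q=1,\dots,Q$ let $$h_{q,s,i}=g_{s,i}\,e^{j\frac{2\pi d}{\lambda}\left(((q-1)\bmod Q_h)\sin\phi_{s,i}\sin\theta_{s,i}+\lfloor (q-1)/Q_h\rfloor\cos\theta_{s,i}\right)},\qquad \mathbf H_{q,s}=\sum_{i=1}^{L_s}h_{q,s,i}\mathbf A_{s,i}.$$ Here the rows and columns of $\mathbf A_{s,i}\in\mathbb C^{MN\times MN}$ are indexed by delay-Doppler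 (DD) elements $(k,l)$ and $(k',l')$ with $0\le k,k'<N$, $0\le l,l'<M$; its entry is $0$ unless $l=(l'+l_{s,i})\bmod M$, in which case it equals $$\frac1N\sum_{n=0}^{N-1}e^{j2\pi n\left(\frac{\nu_{s,i}}{\Delta f}-\frac{k-k'}{N}\right)}\cdot\begin{cases}e^{j2\pi\frac{l'}{M}\frac{\nu_{s,i}}{\Delta f}},& l'+l_{s,i}<M,\\ e^{j2\pi\left(\frac{l'}{M}\frac{\nu_{s,i}}{\Delta f}-\frac{k'}{N}-\frac{\nu_{s,i}}{\Delta f}\right)},& l'+l_{s,i}\ge M.\end{cases}$$ Let $\eta=QMN\sum_{s,i}\beta_{s,i}$, $\rho=\frac{E_T/(NT)}{M\Delta f N_0}=\frac{E_T}{MNN_0}$, $\mathbf G_{s,s'}=\sum_{q}\mathbf H_{q,s}\mathbf H_{q,s'}^H$, and let $\gamma_{s,s',r,p}$ be the $(r,p)$ entry of $\mathbf G_{s,s'}$. In each frame the base station precodes the information symbol vectors $\mathbf u_s$ of the users into $\mathbf x_q=\sqrt{E_T/\eta}\sum_{s}\mathbf H_{q,s}^H\mathbf u_s$, and user $s$ receives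 $\widehat{\mathbf x}_s=\sum_{q}\mathbf H_{q,s}\mathbf x_q+\mathbf w_s$. The information symbols are i.i.d. $\mathcal{CN}(0,1)$, and $\mathbf w_s$ has i.i.d. $\mathcal{CN}(0,N_0)$ entries independent of them. Put $$\mathrm{SINR}_{s,r}=\frac{|\gamma_{s,s,r,r}|^2}{\frac{\eta}{\rho MN}+\sum_{p\ne r}|\gamma_{s,s,r,p}|^2+\sum_{s'\ne s}\sum_{p}|\gamma_{s,s',r,p}|^2}.$$ Then for every user $s$ and DD element $r$ the single-input single-output sub-channel from $u_{s,r}$ to $\widehat x_{s,r}$ has mutual information $I(u_{s,r};\widehat x_{s,r})=\log_2(1+\mathrm{SINR}_{s,r})$ bits. Moreover, the spectral efficiency achieved by the low-complexity detector, which decodes each sub-channel separately, is for user $s$ $$R_s(\mathcal P)=\frac{1}{MN\left(1+\frac{\tau_{\max}}{NT}\right)}\sum_{r}\log_2(1+\mathrm{SINR}_{s,r}).$$ The second claim means the following. Codewords span $F$ frames. Each sub-channel $(s,r)$ has its own codebook with at least $2^{F R_{s,r}}$ codewords, where $R_{s,r}\ge0$; all code symbols are i.i.d. $\mathcal{CN}(0,1)$,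 and the messages are independent of the codebooks and uniformly distributed. The decoder of sub-channel $(s,r)$ is a measurable function of the codebook of this sub-channel and of the $F$ symbols received on it. Rates $(R_{s,r})$ are achievable if for suitable codebook sizes and decoders all the error probabilities (averaged over messages, codebooks and noise, which is independent from frame to frame) tend to $0$ as $F\to\infty$; they give user $s$ the spectral efficiency $\sum_r R_{s,r}$ divided by the time-bandwidth product $M\Delta f(\tau_{\max}+NT)$ of a frame. For every $\varepsilon>0$ some achievable rates give every user $s$ simultaneously a spectral efficiency greater than $R_s(\mathcal P)-\varepsilon$, and no achievable rates give any user $s$ more than $R_s(\mathcal P)$. -/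

import Mathlib

open MeasureTheory ProbabilityTheory Filter Topology
open scoped NNReal ENNReal Matrix

noncomputable section

/-- The law `𝒞𝒩(0, v)` of a zero-mean circularly symmetric complex Gaussian random variable of
variance `v`: real and imaginary parts are independent and real Gaussian of variance `v / 2`. -/
def complexGaussian (v : ℝ≥0) : Measure ℂ :=
  ((gaussianReal 0 (v / 2)).prod (gaussianReal 0 (v / 2))).map
    Complex.measurableEquivRealProd.symm

/-- The mutual information (in bits) of two random variables: the Kullback-Leibler divergence of
their joint law from the product of their laws (in nats), divided by `log 2`. -/
def mutualInfoBits {Ω α β : Type*} [MeasurableSpace Ω] [MeasurableSpace α] [MeasurableSpace β]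
    (μ : Measure Ω) (X : Ω → α) (Y : Ω → β) : ℝ≥0∞ :=
  InformationTheory.klDiv (μ.map fun ω => (X ω, Y ω)) ((μ.map X).prod (μ.map Y)) /
    ENNReal.ofReal (Real.log 2)

/-- `e^{j 2 π x}`. -/
def cis (x : ℝ) : ℂ := Complex.exp (2 * Real.pi * x * Complex.I)

/-- The delay-Doppler resource elements `(k, l)`, `k` the Doppler index and `l` the delay index. -/
abbrev DDRE (M N : ℕ) : Type := Fin N × Fin M

/-- System and channel parameters of the multi-user downlink: `K` single-antenna user terminals, a
`Qv × Qh` uniform rectangular array at the base station, `M × N` delay-Doppler resource elements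
and `L s` paths to the `s`-th user terminal. The path gains `g s i` are fixed complex
numbers; `beta s i` is the mean power of the `i`-th path, which enters the power normalization. -/
structure OTFSSystem (K Qh Qv M N : ℕ) (L : Fin K → ℕ) where
  /-- width of the delay domain, in seconds; the width of the Doppler domain is `1 / T` -/
  T : ℝ
  T_pos : 0 < T
  /-- distance of adjacent antenna elements -/
  d : ℝ
  d_pos : 0 < d
  /-- carrier wavelength -/
  wavelength : ℝ
  wavelength_pos : 0 < wavelength
  /-- mean energy of the precoded symbols of a frame -/
  ET : ℝ
  ET_pos : 0 < ET
  /-- power spectral density of the noise -/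
  N0 : ℝ
  N0_pos : 0 < N0
  /-- zenith angle of departure -/
  theta : ∀ s, Fin (L s) → ℝ
  /-- azimuthal angle of departure -/
  phi : ∀ s, Fin (L s) → ℝ
  /-- Doppler shift -/
  nu : ∀ s, Fin (L s) → ℝ
  /-- delay, in units of `T / M` -/
  tap : ∀ s, Fin (L s) → Fin M
  /-- path gain -/
  g : ∀ s, Fin (L s) → ℂ
  /-- mean path power -/
  beta : ∀ s, Fin (L s) → ℝ
  beta_pos : ∀ s i, 0 < beta s i

namespace OTFSSystem

variable {K Qh Qv M N : ℕ} {L : Fin K → ℕ} (P : OTFSSystem K Qh Qv M N L)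

/-- Subcarrier spacing `Δf = 1 / T`. -/
def deltaF : ℝ := 1 / P.T

/-- The path delay `τ_{s,i}`, an integer multiple of `T / M`. -/
def tau (s : Fin K) (i : Fin (L s)) : ℝ := ((P.tap s i : ℕ) : ℝ) * (P.T / M)

/-- The largest path delay, which is the duration of the cyclic prefix. -/
def tauMax : ℝ := ⨆ p : (Σ s : Fin K, Fin (L s)), P.tau p.1 p.2

/-- The gain `h_{q,s,i}` of the `i`-th path from the `q`-th antenna to the `s`-th user terminal
(`q` is counted from zero). -/
def pathGain (q : Fin (Qh * Qv)) (s : Fin K) (i : Fin (L s)) : ℂ :=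
  P.g s i * cis (P.d / P.wavelength *
    ((((q : ℕ) % Qh : ℕ) : ℝ) * (Real.sin (P.phi s i) * Real.sin (P.theta s i)) +
      (((q : ℕ) / Qh : ℕ) : ℝ) * Real.cos (P.theta s i)))

/-- The delay-Doppler domain matrix `A_{s,i}` of the `i`-th path to the `s`-th user terminal. The
row index is `(k, l)`, the column index is `(k', l')`. -/
def pathMatrix (s : Fin K) (i : Fin (L s)) : Matrix (DDRE M N) (DDRE M N) ℂ :=
  Matrix.of fun r c =>
    if (r.2 : ℕ) = ((c.2 : ℕ) + P.tap s i) % M then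
      (1 / (N : ℂ) * ∑ n : Fin N,
        cis ((n : ℕ) * (P.nu s i / P.deltaF - (((r.1 : ℕ) : ℝ) - ((c.1 : ℕ) : ℝ)) / N))) *
      (if (c.2 : ℕ) + P.tap s i < M then
        cis (((c.2 : ℕ) : ℝ) / M * (P.nu s i / P.deltaF))
      else
        cis (((c.2 : ℕ) : ℝ) / M * (P.nu s i / P.deltaF) - ((c.1 : ℕ) : ℝ) / N
          - P.nu s i / P.deltaF))
    else 0

/-- The effective delay-Doppler domain channel matrix `H_{q,s}`. -/
def H (q : Fin (Qh * Qv)) (s : Fin K) : Matrix (DDRE M N) (DDRE M N) ℂ :=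
  ∑ i : Fin (L s), P.pathGain q s i • P.pathMatrix s i

/-- The power normalization `η = Q M N ∑_s ∑_i β_{s,i}`, with `Q = Qh Qv`. -/
def eta : ℝ := ((Qh * Qv : ℕ) : ℝ) * M * N * ∑ s, ∑ i, P.beta s i

/-- The ratio `ρ` of the mean transmitted power to the noise power at the receiver. -/
def rho : ℝ := (P.ET / (N * P.T)) / (M * P.deltaF * P.N0)

/-- The precoder: the vector `x_q = √(E_T / η) ∑_s H_{q,s}ᴴ u_s` sent from the `q`-th antenna. -/
def precode (q : Fin (Qh * Qv)) (u : Fin K → DDRE M N → ℂ) : DDRE M N → ℂ :=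
  ((Real.sqrt (P.ET / P.eta) : ℝ) : ℂ) • ∑ s, (P.H q s)ᴴ *ᵥ u s

/-- The delay-Doppler domain vector `∑_q H_{q,s} x_q + w_s` received by the `s`-th user terminal in
one frame, for information symbols `u` and noise samples `w`. -/
def receive (s : Fin K) (u : Fin K → DDRE M N → ℂ) (w : DDRE M N → ℂ) : DDRE M N → ℂ :=
  ∑ q, P.H q s *ᵥ P.precode q u + w

/-- `G_{s,s'} = ∑_q H_{q,s} H_{q,s'}ᴴ`. -/
def G (s s' : Fin K) : Matrix (DDRE M N) (DDRE M N) ℂ := ∑ q, P.H q s * (P.H q s')ᴴ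

/-- The signal to interference and noise ratio of the `r`-th sub-channel of the `s`-th user
terminal; `γ_{s,s',r,p}` is the entry `P.G s s' r p`. -/
def sinr (s : Fin K) (r : DDRE M N) : ℝ :=
  ‖P.G s s r r‖ ^ 2 /
    (P.eta / (P.rho * M * N)
      + ∑ p ∈ Finset.univ.erase r, ‖P.G s s r p‖ ^ 2
      + ∑ s' ∈ Finset.univ.erase s, ∑ p, ‖P.G s s' r p‖ ^ 2)

/-- Joint law of the i.i.d. `𝒞𝒩(0, 1)` information symbols of all user terminals and the i.i.d.
`𝒞𝒩(0, N₀)` noise samples at one user terminal, in one frame. -/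
def frameLaw : Measure ((Fin K → DDRE M N → ℂ) × (DDRE M N → ℂ)) :=
  (Measure.pi fun _ => Measure.pi fun _ => complexGaussian 1).prod
    (Measure.pi fun _ => complexGaussian P.N0.toNNReal)

/-- Codebooks for codewords spanning `F` frames: `C s r a f` is the symbol that the codeword of
message `a` on the `r`-th sub-channel of the `s`-th user terminal has in frame `f`. -/
abbrev Codebooks (F : ℕ) (m : Fin K → DDRE M N → ℕ) : Type :=
  ∀ s r, Fin (m s r) → Fin F → ℂ

/-- One message for each sub-channel of each user terminal. -/
abbrev Messages (m : Fin K → DDRE M N → ℕ) : Type := ∀ s r, Fin (m s r)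

/-- Decoder of a single sub-channel with `m` messages: it sees the codebook of this sub-channel and
the symbols received on this sub-channel in the `F` frames, and nothing else. -/
abbrev SubchannelDecoder (F m : ℕ) : Type := (Fin m → Fin F → ℂ) × (Fin F → ℂ) → Fin m

/-- Joint law of uniformly distributed messages, Gaussian codebooks (all code symbols are i.i.d.
`𝒞𝒩(0, 1)`) and the noise at one user terminal in `F` frames; these three are independent. -/
def codingLaw (F : ℕ) (m : Fin K → DDRE M N → ℕ) :
    Measure (Messages m × Codebooks F m × (Fin F → DDRE M N → ℂ)) :=
  (uniformOn Set.univ).prod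
    ((Measure.pi fun _ => Measure.pi fun _ => Measure.pi fun _ => Measure.pi fun _ =>
        complexGaussian 1).prod
      (Measure.pi fun _ => Measure.pi fun _ => complexGaussian P.N0.toNNReal))

/-- Symbols received by the `s`-th user terminal on its `r`-th sub-channel in the `F` frames. -/
def received (s : Fin K) (r : DDRE M N) {F : ℕ} {m : Fin K → DDRE M N → ℕ}
    (msg : Messages m) (C : Codebooks F m) (w : Fin F → DDRE M N → ℂ) : Fin F → ℂ :=
  fun f => P.receive s (fun s' p => C s' p (msg s' p) f) (w f) r

/-- Probability that the message on the `r`-th sub-channel of the `s`-th user terminal is decoded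
wrongly by `dec`. -/
def errorProb (s : Fin K) (r : DDRE M N) (F : ℕ) (m : Fin K → DDRE M N → ℕ)
    (dec : SubchannelDecoder F (m s r)) : ℝ≥0∞ :=
  P.codingLaw F m {ω | dec (ω.2.1 s r, P.received s r ω.1 ω.2.1 ω.2.2) ≠ ω.1 s r}

/-- The rates `R s r` (bits per frame on the `r`-th sub-channel of the `s`-th user terminal) are
simultaneously achieved by separate decoding of each sub-channel: there are
at least `2 ^ (F R s r)` messages for codewords spanning `F` frames, and all the error
probabilities tend to zero as `F` grows. -/
def LCDAchievable (R : Fin K → DDRE M N → ℝ) : Prop :=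
  (∀ s r, 0 ≤ R s r) ∧
  ∃ (m : ℕ → Fin K → DDRE M N → ℕ) (dec : ∀ F s r, SubchannelDecoder F (m F s r)),
    (∀ (F : ℕ) s r, (2 : ℝ) ^ ((F : ℝ) * R s r) ≤ m F s r) ∧
    (∀ F s r, Measurable (dec F s r)) ∧
    ∀ s r, Tendsto (fun F => P.errorProb s r F (m F) (dec F s r)) atTop (𝓝 0)

/-- Spectral efficiency of the `s`-th user terminal at rates `R`: bits per frame divided by the
time-bandwidth product `M Δf (τ_max + N T)` of a frame with its cyclic prefix. -/
def spectralEfficiency (R : Fin K → DDRE M N → ℝ) (s : Fin K) : ℝ :=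
  (∑ r, R s r) / (M * P.deltaF * (P.tauMax + N * P.T))

/-- `S s`, for all user terminals `s` simultaneously, is the spectral efficiency achieved by separate
decoding of the sub-channels: achievable rates come arbitrarily close to all the `S s` at
once, and no achievable rates exceed any of them. -/
def IsLCDSpectralEfficiency (S : Fin K → ℝ) : Prop :=
  (∀ ε > 0, ∃ R, P.LCDAchievable R ∧ ∀ s, S s - ε < P.spectralEfficiency R s) ∧
  ∀ R, P.LCDAchievable R → ∀ s, P.spectralEfficiency R s ≤ S s

end OTFSSystem

end

/-! Each received symbol is `g * u + z`, where `u` is the wanted symbol and `z` collects all other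
symbols, weighted by entries of `G`, and the noise (`receive_apply`). Everything is Gaussian and
independent, so `z` is complex Gaussian with variance `σ = noiseVar` and independent of `u`, and the
output is complex Gaussian with variance `v = outputVar = ‖g‖ ^ 2 + σ`. The power normalization
makes `v / σ = 1 + SINR` (`outputVar_div_noiseVar`). Thus everything reduces to one scalar Gaussian
channel.

The joint law of input and output has an explicit density `shiftRatio` with respect to the product
of the marginals. Its logarithm, the information density, has mean `log (v / σ)`, because the two
quadratic terms average to `1` and cancel (`integral_log_shiftRatio`). This mean is the mutual
information in nats.

For coding, a decoder sees only its own codebook. For fixed messages, the interference from the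
other random codebooks is therefore i.i.d. Gaussian noise, independent of that codebook
(`map_codebookAndNoise`). The weak law concentrates the normalized information density of the sent
codeword at `log (v / σ)`. Below this rate, a threshold decoder works: a wrong codeword passes the
threshold with exponentially small probability, by a change of measure and a union bound
(`exists_decoder`). Above it, replacing the channel output by one independent of the codebook costs
a factor of at most `exp t` on typical outcomes. Under the replaced law the decoding regions of all
messages have total mass one, so the average probability of correct decoding tends to zero
(`sum_correct_le`). The converse needs the bound for Gaussian codebooks only, as the error is
averaged over them. -/

/-! ### The complex Gaussian law: characteristic function, density, second moment -/

instance instIsProbabilityMeasureComplexGaussian (v : ℝ≥0) :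
    IsProbabilityMeasure (complexGaussian v) :=
  Measure.isProbabilityMeasure_map Complex.measurableEquivRealProd.symm.measurable.aemeasurable

lemma charFunDual_gaussianReal_zero (v : ℝ≥0) (L : StrongDual ℝ ℝ) :
    charFunDual (gaussianReal 0 v) L = Complex.exp (-((v * L 1 ^ 2 / 2 : ℝ) : ℂ)) := by
  rw [charFunDual_eq_charFun_map_one, gaussianReal_map_continuousLinearMap, charFun_gaussianReal]
  congr 1
  simp [max_eq_left (sq_nonneg (L 1))]
  ring

/-- The characteristic function of `𝒞𝒩(0, v)`. -/
lemma charFunDual_complexGaussian (v : ℝ≥0) (L : StrongDual ℝ ℂ) :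
    charFunDual (complexGaussian v) L =
      Complex.exp (-((v * (L 1 ^ 2 + L Complex.I ^ 2) / 4 : ℝ) : ℂ)) := by
  have h : complexGaussian v = ((gaussianReal 0 (v / 2)).prod (gaussianReal 0 (v / 2))).map
      (Complex.equivRealProdCLM.symm : ℝ × ℝ →L[ℝ] ℂ) := rfl
  rw [h, charFunDual_map, charFunDual_prod, charFunDual_gaussianReal_zero,
    charFunDual_gaussianReal_zero, ← Complex.exp_add]
  congr 1
  have h1 : (Complex.equivRealProdCLM.symm (1, 0) : ℂ) = 1 := by
    apply Complex.ext <;> simp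
  have h2 : (Complex.equivRealProdCLM.symm (0, 1) : ℂ) = Complex.I := by
    apply Complex.ext <;> simp
  simp [h1, h2]
  ring

/-- The density of `𝒞𝒩(0, v)`. -/
noncomputable def complexGaussianPDF (v : ℝ≥0) (z : ℂ) : ℝ≥0∞ :=
  ENNReal.ofReal ((Real.pi * v)⁻¹ * Real.exp (-‖z‖ ^ 2 / v))

@[fun_prop]
lemma measurable_complexGaussianPDF (v : ℝ≥0) : Measurable (complexGaussianPDF v) := by
  unfold complexGaussianPDF
  fun_prop

lemma complexGaussian_eq_withDensity {v : ℝ≥0} (hv : v ≠ 0) :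
    complexGaussian v = volume.withDensity (complexGaussianPDF v) := by
  have hv2 : v / 2 ≠ 0 := by positivity
  rw [complexGaussian, gaussianReal_of_var_ne_zero 0 hv2, prod_withDensity (by fun_prop)
    (by fun_prop)]
  ext s hs
  rw [Measure.map_apply Complex.measurableEquivRealProd.symm.measurable hs,
    withDensity_apply _ (Complex.measurableEquivRealProd.symm.measurable hs),
    withDensity_apply _ hs, ← Measure.volume_eq_prod,
    ← Complex.volume_preserving_equiv_real_prod.symm.setLIntegral_comp_preimage hs (by fun_prop)]
  refine lintegral_congr fun x => ?_
  rw [gaussianPDF, gaussianPDF, ← ENNReal.ofReal_mul (gaussianPDFReal_nonneg _ _ _),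
    complexGaussianPDF]
  congr 1
  have hv' : (0 : ℝ) < v := by positivity
  have hx : ‖Complex.measurableEquivRealProd.symm x‖ ^ 2 = x.1 ^ 2 + x.2 ^ 2 := by
    rw [← Complex.normSq_eq_norm_sq, Complex.normSq_apply, Complex.measurableEquivRealProd_symm_apply]
    ring
  rw [hx, gaussianPDFReal, gaussianPDFReal, mul_mul_mul_comm, ← Real.exp_add, ← mul_inv,
    Real.mul_self_sqrt (by positivity)]
  congr 2
  · push_cast
    ring
  · push_cast
    field_simp
    ring

/-- The likelihood ratio of `𝒞𝒩(c, σ)` and `𝒞𝒩(0, v)`. -/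
noncomputable def shiftRatio (σ v : ℝ≥0) (c y : ℂ) : ℝ :=
  v / σ * Real.exp (‖y‖ ^ 2 / v - ‖y - c‖ ^ 2 / σ)

lemma shiftRatio_pos {σ v : ℝ≥0} (hσ : σ ≠ 0) (hv : v ≠ 0) (c y : ℂ) : 0 < shiftRatio σ v c y := by
  unfold shiftRatio
  positivity

lemma log_shiftRatio {σ v : ℝ≥0} (hσ : σ ≠ 0) (hv : v ≠ 0) (c y : ℂ) :
    Real.log (shiftRatio σ v c y) = Real.log (v / σ) + ‖y‖ ^ 2 / v - ‖y - c‖ ^ 2 / σ := by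
  have h1 : (0 : ℝ) < σ := by positivity
  have h2 : (0 : ℝ) < v := by positivity
  rw [shiftRatio, Real.log_mul (by positivity) (by positivity), Real.log_exp]
  ring

/-- This change of measure underlies both the mutual information and the coding bounds: given the
input, the output law is compared with a Gaussian reference law that does not depend on the input.
-/
lemma complexGaussian_map_const_add {σ v : ℝ≥0} (hσ : σ ≠ 0) (hv : v ≠ 0) (c : ℂ) :
    (complexGaussian σ).map (c + ·) =
      (complexGaussian v).withDensity fun y => ENNReal.ofReal (shiftRatio σ v c y) := by
  have hm : Measurable fun y => ENNReal.ofReal (shiftRatio σ v c y) :=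
    by unfold shiftRatio; fun_prop
  rw [complexGaussian_eq_withDensity hσ, complexGaussian_eq_withDensity hv,
    ← withDensity_mul volume (measurable_complexGaussianPDF v) hm]
  ext s hs
  rw [Measure.map_apply (by fun_prop) hs, withDensity_apply _ (hs.preimage (by fun_prop)),
    withDensity_apply _ hs,
    ← (measurePreserving_add_left volume c).setLIntegral_comp_preimage hs
      ((measurable_complexGaussianPDF v).mul hm)]
  refine lintegral_congr fun x => ?_
  have h1 : (0 : ℝ) < σ := by positivity
  have h2 : (0 : ℝ) < v := by positivity
  rw [Pi.mul_apply, complexGaussianPDF, complexGaussianPDF, ← ENNReal.ofReal_mul (by positivity),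
    shiftRatio]
  congr 1
  rw [mul_mul_mul_comm, ← Real.exp_add]
  congr 1
  · field_simp
  · congr 1
    rw [add_sub_cancel_left]
    ring

lemma memLp_two_id_gaussianReal (v : ℝ≥0) : MemLp id 2 (gaussianReal 0 v) :=
  memLp_id_gaussianReal 2

lemma integrable_sq_gaussianReal (v : ℝ≥0) : Integrable (fun x => x ^ 2) (gaussianReal 0 v) :=
  (memLp_two_id_gaussianReal v).integrable_sq

lemma integral_sq_gaussianReal (v : ℝ≥0) : ∫ x, x ^ 2 ∂gaussianReal 0 v = v := by
  have h := variance_fun_id_gaussianReal (μ := 0) (v := v)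
  rw [variance_of_integral_eq_zero (by fun_prop) (by simp)] at h
  simpa using h

lemma complexGaussian_norm_sq (v : ℝ≥0) :
    Integrable (fun z => ‖z‖ ^ 2) (complexGaussian v) ∧ ∫ z, ‖z‖ ^ 2 ∂complexGaussian v = v := by
  have hx (x : ℝ × ℝ) : ‖Complex.measurableEquivRealProd.symm x‖ ^ 2 = x.1 ^ 2 + x.2 ^ 2 := by
    rw [← Complex.normSq_eq_norm_sq, Complex.normSq_apply,
      Complex.measurableEquivRealProd_symm_apply]
    ring
  have i1 : Integrable (fun x : ℝ × ℝ => x.1 ^ 2)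
      ((gaussianReal 0 (v / 2)).prod (gaussianReal 0 (v / 2))) :=
    (integrable_sq_gaussianReal _).comp_fst _
  have i2 : Integrable (fun x : ℝ × ℝ => x.2 ^ 2)
      ((gaussianReal 0 (v / 2)).prod (gaussianReal 0 (v / 2))) :=
    (integrable_sq_gaussianReal _).comp_snd _
  constructor
  · rw [complexGaussian, integrable_map_equiv]
    refine (i1.add i2).congr (ae_of_all _ fun x => ?_)
    exact (hx x).symm
  · rw [complexGaussian, integral_map_equiv]
    simp only [hx]
    rw [integral_add i1 i2, integral_fun_fst (fun x : ℝ => x ^ 2),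
      integral_fun_snd (fun x : ℝ => x ^ 2), integral_sq_gaussianReal]
    simp

lemma pi_withDensity {ι : Type*} [Fintype ι] {α : ι → Type*} [∀ i, MeasurableSpace (α i)]
    (μ : ∀ i, Measure (α i)) [∀ i, IsProbabilityMeasure (μ i)] (f : ∀ i, α i → ℝ≥0∞)
    (hf : ∀ i, Measurable (f i)) [∀ i, SigmaFinite ((μ i).withDensity (f i))] :
    Measure.pi (fun i => (μ i).withDensity (f i)) =
      (Measure.pi μ).withDensity fun x => ∏ i, f i (x i) := by
  refine Measure.pi_eq fun s hs => ?_
  rw [withDensity_apply _ (MeasurableSet.univ_pi hs), ← lintegral_indicator (.univ_pi hs)]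
  -- On a rectangle the integrand factors over the coordinates, which are independent, so the
  -- integral factors too.
  have h (x : ∀ i, α i) : (Set.univ.pi s).indicator (fun x => ∏ i, f i (x i)) x =
      ∏ i, (s i).indicator (f i) (x i) := by
    classical
    by_cases hx : x ∈ Set.univ.pi s
    · rw [Set.indicator_of_mem hx]
      exact Finset.prod_congr rfl fun i _ => (Set.indicator_of_mem (hx i trivial) _).symm
    · rw [Set.indicator_of_notMem hx]
      obtain ⟨i, hi⟩ : ∃ i, x i ∉ s i := by simpa [Set.mem_pi] using hx
      exact (Finset.prod_eq_zero (Finset.mem_univ i) (Set.indicator_of_notMem hi _)).symm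
  simp_rw [h]
  have hind : iIndepFun (fun i (x : ∀ i, α i) => (s i).indicator (f i) (x i)) (Measure.pi μ) :=
    iIndepFun_pi fun i => ((hf i).indicator (hs i)).aemeasurable
  have := lintegral_prod_eq_prod_lintegral_of_indepFun Finset.univ _ hind
    fun i => ((hf i).indicator (hs i)).comp (measurable_pi_apply i)
  refine (lintegral_congr fun x => ?_).trans (this.trans ?_)
  · simp
  refine Finset.prod_congr rfl fun i _ => ?_
  have := (measurePreserving_eval μ i).lintegral_comp ((hf i).indicator (hs i))
  rw [withDensity_apply _ (hs i), ← lintegral_indicator (hs i)]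
  exact this

/-- Multiplication by `c` is a rotation followed by scaling with `‖c‖`, and the quadratic form is
rotation invariant. This is the circular symmetry of the law: only the modulus of a channel
coefficient matters. -/
lemma dual_const_mul_sq (L : ℂ →ₗ[ℝ] ℝ) (c : ℂ) :
    L c ^ 2 + L (c * Complex.I) ^ 2 = ‖c‖ ^ 2 * (L 1 ^ 2 + L Complex.I ^ 2) := by
  have h (a b : ℝ) : L (a + b * Complex.I) = a * L 1 + b * L Complex.I := by
    have : (a + b * Complex.I : ℂ) = a • (1 : ℂ) + b • Complex.I := by simp
    rw [this, map_add, map_smul, map_smul, smul_eq_mul, smul_eq_mul]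
  have h1 : L c = c.re * L 1 + c.im * L Complex.I := by rw [← h, Complex.re_add_im]
  have h2 : L (c * Complex.I) = -c.im * L 1 + c.re * L Complex.I := by
    have : c * Complex.I = ((-c.im : ℝ) : ℂ) + (c.re : ℝ) * Complex.I := by
      apply Complex.ext <;> simp
    rw [this, h]
  rw [h1, h2, ← Complex.normSq_eq_norm_sq, Complex.normSq_apply]
  ring

/-! ### One symbol and its interference within a frame -/

section SingleFrame

variable {S D : Type*} [Fintype S] [Fintype D] [DecidableEq S] [DecidableEq D]

/-- One symbol of a frame, together with a linear combination of the other symbols and the noise. -/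
def symbolAndNoise (s : S) (r : D) (c : S → D → ℂ) :
    ((S → D → ℂ) × (D → ℂ)) →ₗ[ℝ] ℂ × ℂ where
  toFun ω := (ω.1 s r, ∑ s', ∑ p, c s' p * ω.1 s' p + ω.2 r)
  map_add' x y := by
    simp only [Prod.fst_add, Prod.snd_add, Pi.add_apply, mul_add, Finset.sum_add_distrib,
      Prod.mk_add_mk]
    congr 1
    ring
  map_smul' a x := by
    simp only [Prod.smul_fst, Prod.smul_snd, Pi.smul_apply, Prod.smul_mk, RingHom.id_apply,
      mul_smul_comm, ← Finset.smul_sum, smul_add]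

/-- Both laws are centred Gaussian, so their characteristic functions agree once two quadratic forms
in `L` do. Since `c s r = 0`, every basis vector is sent into only one of the two components; hence
no cross terms arise, which gives independence. -/
lemma map_symbolAndNoise {s : S} {r : D} {c : S → D → ℂ} (hc : c s r = 0) (n σ : ℝ≥0)
    (hσ : (σ : ℝ) = ∑ s', ∑ p, ‖c s' p‖ ^ 2 + n) :
    ((Measure.pi fun _ : S => Measure.pi fun _ : D => complexGaussian 1).prod
      (Measure.pi fun _ : D => complexGaussian n)).map (symbolAndNoise s r c) =
      (complexGaussian 1).prod (complexGaussian σ) := by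
  refine Measure.ext_of_charFunDual (funext fun L => ?_)
  have hT : ⇑(symbolAndNoise s r c) = ⇑(symbolAndNoise s r c).toContinuousLinearMap := rfl
  rw [hT, charFunDual_map]
  simp only [charFunDual_prod, charFunDual_pi, charFunDual_complexGaussian]
  simp only [← Complex.exp_sum, ← Complex.exp_add, ← Complex.ofReal_neg, ← Complex.ofReal_sum,
    ← Complex.ofReal_add]
  congr 2
  have hu (s' : S) (p : D) (w : ℂ) :
      symbolAndNoise s r c (Pi.single s' (Pi.single p w), 0) =
        if s' = s ∧ p = r then (w, 0) else (0, c s' p * w) := by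
    have h2 : ∑ s'', ∑ p', c s'' p' * (Pi.single s' (Pi.single p w) : S → D → ℂ) s'' p' =
        c s' p * w := by
      rw [Finset.sum_eq_single s' (fun b _ hb => by simp [hb]) (by simp),
        Finset.sum_eq_single p (fun b _ hb => by simp [hb]) (by simp)]
      simp
    simp only [symbolAndNoise, LinearMap.coe_mk, AddHom.coe_mk, h2]
    split_ifs with h
    · obtain ⟨rfl, rfl⟩ := h
      simp [hc]
    · have : (Pi.single s' (Pi.single p w) : S → D → ℂ) s r = 0 := by
        by_cases h1 : s' = s
        · subst h1
          have h2 : p ≠ r := fun h' => h ⟨rfl, h'⟩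
          simp [h2.symm]
        · simp [Ne.symm h1]
      simp [this]
  have hw (p : D) (w : ℂ) :
      symbolAndNoise s r c (0, Pi.single p w) = if p = r then (0, w) else 0 := by
    simp only [symbolAndNoise, LinearMap.coe_mk, AddHom.coe_mk]
    split_ifs with h
    · subst h
      simp
    · simp [Ne.symm h]
  have hB (x : ℂ) : L (0, x) ^ 2 + L (0, x * Complex.I) ^ 2 =
      ‖x‖ ^ 2 * (L (0, 1) ^ 2 + L (0, Complex.I) ^ 2) :=
    dual_const_mul_sq (L.toLinearMap ∘ₗ LinearMap.inr ℝ ℂ ℂ) x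
  have hq (s' : S) (p : D) :
      L (symbolAndNoise s r c (Pi.single s' (Pi.single p 1), 0)) ^ 2 +
        L (symbolAndNoise s r c (Pi.single s' (Pi.single p Complex.I), 0)) ^ 2 =
      (if s' = s then if p = r then L (1, 0) ^ 2 + L (Complex.I, 0) ^ 2 else 0 else 0) +
        ‖c s' p‖ ^ 2 * (L (0, 1) ^ 2 + L (0, Complex.I) ^ 2) := by
    rw [hu, hu, ← ite_and]
    split_ifs with h
    · obtain ⟨rfl, rfl⟩ := h
      simp [hc]
    · rw [mul_one, hB, zero_add]
  have hn (p : D) :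
      L (symbolAndNoise s r c (0, Pi.single p 1)) ^ 2 +
        L (symbolAndNoise s r c (0, Pi.single p Complex.I)) ^ 2 =
      if p = r then L (0, 1) ^ 2 + L (0, Complex.I) ^ 2 else 0 := by
    rw [hw, hw]
    split_ifs <;> simp
  simp only [NNReal.coe_one, ContinuousLinearMap.comp_apply, ContinuousLinearMap.single_apply,
    ContinuousLinearMap.inl_apply, LinearMap.coe_toContinuousLinearMap', one_mul,
    Finset.sum_neg_distrib, ContinuousLinearMap.inr_apply, hq, hn, ← Finset.sum_div,
    Finset.sum_add_distrib, ← Finset.sum_mul, ← Finset.mul_sum, Finset.sum_ite_eq',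
    Finset.sum_ite_irrel, Finset.sum_const_zero, Finset.mem_univ, if_true, hσ]
  ring

end SingleFrame

/-! ### One codebook and its interference over several frames -/

section Codebook

variable {S D : Type*} [Fintype S] [Fintype D] [DecidableEq S] [DecidableEq D] {F : ℕ}
  {m : S → D → ℕ}

/-- The codebook of one sub-channel, together with a linear combination of the transmitted symbols
of the other sub-channels and the noise. -/
def codebookAndNoise (s : S) (r : D) (c : S → D → ℂ) (msg : ∀ s r, Fin (m s r)) :
    ((∀ s r, Fin (m s r) → Fin F → ℂ) × (Fin F → D → ℂ)) →ₗ[ℝ]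
      (Fin (m s r) → Fin F → ℂ) × (Fin F → ℂ) where
  toFun ω := (ω.1 s r, fun f => ∑ s', ∑ p, c s' p * ω.1 s' p (msg s' p) f + ω.2 f r)
  map_add' x y := by
    ext
    · simp
    · simp only [Prod.fst_add, Prod.snd_add, Pi.add_apply, mul_add, Finset.sum_add_distrib]
      ring
  map_smul' a x := by
    ext
    · simp
    · simp only [Prod.smul_fst, Prod.smul_snd, Pi.smul_apply, RingHom.id_apply,
        mul_smul_comm, ← Finset.smul_sum, smul_add]

/-- The argument is again a comparison of quadratic forms. With the messages fixed, each interfering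
sub-channel contributes only its sent codeword, whose symbols in different frames are independent,
so the interference is white over the frames. -/
lemma map_codebookAndNoise {s : S} {r : D} {c : S → D → ℂ} (hc : c s r = 0) (n σ : ℝ≥0)
    (hσ : (σ : ℝ) = ∑ s', ∑ p, ‖c s' p‖ ^ 2 + n) (msg : ∀ s r, Fin (m s r)) :
    ((Measure.pi fun s : S => Measure.pi fun r : D => Measure.pi fun _ : Fin (m s r) =>
        Measure.pi fun _ : Fin F => complexGaussian 1).prod
      (Measure.pi fun _ : Fin F => Measure.pi fun _ : D => complexGaussian n)).map
        (codebookAndNoise s r c msg) =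
      (Measure.pi fun _ => Measure.pi fun _ => complexGaussian 1).prod
        (Measure.pi fun _ => complexGaussian σ) := by
  refine Measure.ext_of_charFunDual (funext fun L => ?_)
  have hT : ⇑(codebookAndNoise (F := F) s r c msg) =
    ⇑(codebookAndNoise (F := F) s r c msg).toContinuousLinearMap := rfl
  rw [hT, charFunDual_map]
  simp only [charFunDual_prod, charFunDual_pi, charFunDual_complexGaussian]
  simp only [← Complex.exp_sum, ← Complex.exp_add, ← Complex.ofReal_neg, ← Complex.ofReal_sum,
    ← Complex.ofReal_add]
  congr 2
  have hu2 (s' : S) (p : D) (a : Fin (m s' p)) (f : Fin F) (w : ℂ) :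
      (codebookAndNoise s r c msg
        (Pi.single s' (Pi.single p (Pi.single a (Pi.single f w))), 0)).2 =
        if a = msg s' p then Pi.single f (c s' p * w) else 0 := by
    ext f'
    simp only [codebookAndNoise, LinearMap.coe_mk, AddHom.coe_mk, Pi.zero_apply, add_zero]
    rw [Finset.sum_eq_single s' (fun b _ hb => by simp [hb]) (by simp),
        Finset.sum_eq_single p (fun b _ hb => by simp [hb]) (by simp)]
    rw [Pi.single_eq_same, Pi.single_eq_same]
    split_ifs with h
    · subst h
      rw [Pi.single_eq_same]
      by_cases hf : f' = f
      · subst hf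
        simp
      · simp [hf]
    · simp [Ne.symm h]
  have hu1 (a : Fin (m s r)) (f : Fin F) (w : ℂ) :
      codebookAndNoise s r c msg
        (Pi.single s (Pi.single r (Pi.single a (Pi.single f w))), 0) =
        (Pi.single a (Pi.single f w), 0) := by
    refine Prod.ext ?_ ?_
    · simp [codebookAndNoise]
    · rw [hu2]
      simp [hc]
  have hu0 (s' : S) (p : D) (h : ¬ (s' = s ∧ p = r)) (a : Fin (m s' p)) (f : Fin F) (w : ℂ) :
      codebookAndNoise s r c msg
        (Pi.single s' (Pi.single p (Pi.single a (Pi.single f w))), 0) =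
        if a = msg s' p then (0, Pi.single f (c s' p * w)) else 0 := by
    refine Prod.ext ?_ ?_
    · have : (codebookAndNoise s r c msg
        (Pi.single s' (Pi.single p (Pi.single a (Pi.single f w))), 0)).1 = 0 := by
        simp only [codebookAndNoise, LinearMap.coe_mk, AddHom.coe_mk]
        by_cases h1 : s' = s
        · subst h1
          have h2 : r ≠ p := fun h' => h ⟨rfl, h'.symm⟩
          rw [Pi.single_eq_same, Pi.single_eq_of_ne h2]
        · rw [Pi.single_eq_of_ne (Ne.symm h1), Pi.zero_apply]
      rw [this]
      split_ifs <;> rfl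
    · rw [hu2]
      split_ifs <;> rfl
  have hw (f : Fin F) (p : D) (w : ℂ) :
      codebookAndNoise s r c msg (0, Pi.single f (Pi.single p w)) =
        if p = r then (0, Pi.single f w) else 0 := by
    refine Prod.ext ?_ ?_
    · split_ifs <;> simp [codebookAndNoise]
    · ext f'
      by_cases hf : f' = f
      · subst hf
        split_ifs with h
        · subst h
          simp [codebookAndNoise]
        · simp [codebookAndNoise, Ne.symm h]
      · split_ifs <;> simp [codebookAndNoise, hf]
  have hB (f : Fin F) (x : ℂ) :
      L (0, Pi.single f x) ^ 2 + L (0, Pi.single f (x * Complex.I)) ^ 2 =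
      ‖x‖ ^ 2 * (L (0, Pi.single f 1) ^ 2 + L (0, Pi.single f Complex.I) ^ 2) :=
    dual_const_mul_sq (L.toLinearMap ∘ₗ LinearMap.inr ℝ _ _ ∘ₗ LinearMap.single ℝ (fun _ => ℂ) f) x
  have hq (s' : S) (p : D) :
      ∑ a, ∑ f, (L (codebookAndNoise s r c msg
          (Pi.single s' (Pi.single p (Pi.single a (Pi.single f 1))), 0)) ^ 2 +
        L (codebookAndNoise s r c msg
          (Pi.single s' (Pi.single p (Pi.single a (Pi.single f Complex.I))), 0)) ^ 2) =
      (if s' = s then if p = r then ∑ a, ∑ f, (L (Pi.single a (Pi.single f 1), 0) ^ 2 +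
          L (Pi.single a (Pi.single f Complex.I), 0) ^ 2) else 0 else 0) +
        ‖c s' p‖ ^ 2 * ∑ f, (L (0, Pi.single f 1) ^ 2 + L (0, Pi.single f Complex.I) ^ 2) := by
    rw [← ite_and]
    split_ifs with h
    · obtain ⟨rfl, rfl⟩ := h
      simp only [hu1, hc]
      simp
    · rw [zero_add, Finset.sum_eq_single (msg s' p), Finset.mul_sum]
      · refine Finset.sum_congr rfl fun f _ => ?_
        rw [hu0 s' p h, hu0 s' p h, if_pos rfl, if_pos rfl, mul_one, hB]
      · intro a _ ha
        simp [hu0 s' p h, ha]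
      · simp
  have hn (f : Fin F) (p : D) :
      L (codebookAndNoise s r c msg (0, Pi.single f (Pi.single p 1))) ^ 2 +
        L (codebookAndNoise s r c msg (0, Pi.single f (Pi.single p Complex.I))) ^ 2 =
      if p = r then L (0, Pi.single f 1) ^ 2 + L (0, Pi.single f Complex.I) ^ 2 else 0 := by
    rw [hw, hw]
    split_ifs <;> simp
  simp only [NNReal.coe_one, ContinuousLinearMap.comp_apply, ContinuousLinearMap.single_apply,
    ContinuousLinearMap.inl_apply, LinearMap.coe_toContinuousLinearMap', one_mul,
    Finset.sum_neg_distrib, ContinuousLinearMap.inr_apply, ← Finset.sum_div, hq, hn]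
  simp only [Finset.sum_add_distrib, ← Finset.sum_mul, ← Finset.mul_sum, Finset.sum_ite_eq',
    Finset.sum_ite_irrel, Finset.sum_const_zero, Finset.mem_univ, if_true, hσ]
  ring

end Codebook

/-! ### Output law of the scalar channel -/

section AdditiveNoise

/-- A scaled input plus noise is again complex Gaussian. -/
lemma complexGaussian_map_mul_add (g : ℂ) (σ v : ℝ≥0) (hv : (v : ℝ) = ‖g‖ ^ 2 + σ) :
    ((complexGaussian 1).prod (complexGaussian σ)).map (fun p => g * p.1 + p.2) =
      complexGaussian v := by
  refine Measure.ext_of_charFunDual (funext fun L => ?_)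
  have hT : (fun p : ℂ × ℂ => g * p.1 + p.2) =
    ⇑((g • ContinuousLinearMap.fst ℝ ℂ ℂ + ContinuousLinearMap.snd ℝ ℂ ℂ : ℂ × ℂ →L[ℝ] ℂ)) := rfl
  have hg := dual_const_mul_sq L.toLinearMap g
  rw [ContinuousLinearMap.coe_coe] at hg
  rw [hT, charFunDual_map]
  simp only [charFunDual_prod, charFunDual_complexGaussian, ← Complex.exp_add,
    ← Complex.ofReal_neg, ← Complex.ofReal_add]
  congr 2
  simp [hg, hv]
  ring

lemma pi_complexGaussian_map_mul_add {ι : Type*} [Fintype ι] (g : ℂ) (σ v : ℝ≥0)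
    (hv : (v : ℝ) = ‖g‖ ^ 2 + σ) :
    ((Measure.pi fun _ : ι => complexGaussian 1).prod
      (Measure.pi fun _ : ι => complexGaussian σ)).map (fun p i => g * p.1 i + p.2 i) =
      Measure.pi fun _ => complexGaussian v := by
  rw [← (measurePreserving_arrowProdEquivProdArrow ℂ ℂ ι (fun _ => complexGaussian 1)
    (fun _ => complexGaussian σ)).map_eq, Measure.map_map (by fun_prop) (by fun_prop),
    ← complexGaussian_map_mul_add g σ v hv, ← Measure.pi_map_pi (fun _ => by fun_prop)]
  rfl

end AdditiveNoise

/-! ### Weak law of large numbers -/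

/-- The weak law of large numbers on finite powers of a probability space. -/
lemma tendsto_pi_average_deviation {E : Type*} [MeasurableSpace E] (μ : Measure E)
    [IsProbabilityMeasure μ] {ψ : E → ℝ} (hψ : Measurable ψ) (hint : Integrable ψ μ) {δ : ℝ}
    (hδ : 0 < δ) :
    Tendsto (fun F : ℕ => (Measure.pi fun _ : Fin F => μ)
      {x | δ ≤ |(∑ f, ψ (x f)) / F - ∫ e, ψ e ∂μ|}) atTop (𝓝 0) := by
  -- All finite powers are marginals of one infinite product. There the strong law applies, and
  -- almost sure convergence implies convergence in measure.
  set P := Measure.infinitePi fun _ : ℕ => μ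
  have hev (n : ℕ) : MeasurePreserving (fun ω : ℕ → E => ω n) P μ :=
    measurePreserving_eval_infinitePi _ n
  have hindep : iIndepFun (fun (n : ℕ) (ω : ℕ → E) => ψ (ω n)) P := iIndepFun_infinitePi fun _ => hψ
  have hae := strong_law_ae_real (μ := P) (fun n ω => ψ (ω n))
    ((hev 0).integrable_comp_of_integrable hint) (fun i j hij => hindep.indepFun hij)
    (fun i => ⟨(hψ.comp (hev i).measurable).aemeasurable,
      (hψ.comp (hev 0).measurable).aemeasurable, by
      rw [← Function.comp_def ψ, ← Function.comp_def ψ,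
        ← Measure.map_map hψ (hev i).measurable, ← Measure.map_map hψ (hev 0).measurable,
        (hev i).map_eq, (hev 0).map_eq]⟩)
  have hmean : ∫ ω, ψ (ω 0) ∂P = ∫ e, ψ e ∂μ := by
    have := integral_map (μ := P) (hev 0).measurable.aemeasurable (f := ψ)
      (by rw [(hev 0).map_eq]; exact hψ.aestronglyMeasurable)
    rw [(hev 0).map_eq] at this
    exact this.symm
  rw [hmean] at hae
  have hmeas := tendstoInMeasure_of_tendsto_ae (μ := P)
    (f := fun n ω => (∑ i ∈ Finset.range n, ψ (ω i)) / n) (g := fun _ => ∫ e, ψ e ∂μ)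
    (fun n => Measurable.aestronglyMeasurable (by fun_prop)) hae
  refine (tendstoInMeasure_iff_norm.mp hmeas δ hδ).congr fun F => ?_
  have hmap : P.map (fun ω (f : Fin F) => ω f) = Measure.pi fun _ => μ := by
    rw [Measure.map_infinitePi_infinitePi_of_inj Fin.val_injective, Measure.infinitePi_eq_pi]
  rw [← hmap, Measure.map_apply (by fun_prop) (measurableSet_le (by fun_prop) (by fun_prop))]
  simp only [Finset.sum_range, Real.norm_eq_abs, Set.preimage_ofPred_eq]

/-! ### Random coding bound and converse for the scalar Gaussian channel -/

section GaussianCodebook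

variable (g : ℂ) (σ v : ℝ≥0) (m F : ℕ)

/-- Joint law of a Gaussian codebook and the noise at the receiver. -/
noncomputable def codebookLaw : Measure ((Fin m → Fin F → ℂ) × (Fin F → ℂ)) :=
  (Measure.pi fun _ => Measure.pi fun _ => complexGaussian 1).prod
    (Measure.pi fun _ => complexGaussian σ)

instance instIsProbabilityMeasureCodebookLaw : IsProbabilityMeasure (codebookLaw σ m F) := by
  unfold codebookLaw
  infer_instance

variable {m F}

/-- The codebook and the channel output when message `a` is sent. -/
def channelOutput (a : Fin m) (p : (Fin m → Fin F → ℂ) × (Fin F → ℂ)) :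
    (Fin m → Fin F → ℂ) × (Fin F → ℂ) :=
  (p.1, fun f => g * p.1 a f + p.2 f)

@[fun_prop]
lemma measurable_channelOutput (a : Fin m) : Measurable (channelOutput (F := F) g a) := by
  unfold channelOutput
  fun_prop

/-- The information density between the codeword of message `a` and the channel output. -/
noncomputable def infoDensity (a : Fin m) (p : (Fin m → Fin F → ℂ) × (Fin F → ℂ)) : ℝ :=
  ∑ f, Real.log (shiftRatio σ v (g * p.1 a f) (p.2 f))

@[fun_prop]
lemma measurable_infoDensity (a : Fin m) : Measurable (infoDensity (F := F) g σ v a) := by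
  unfold infoDensity shiftRatio
  fun_prop

/-- Sending a codeword tilts the product of codebook law and output law by the exponential of the
information density. -/
lemma codebookLaw_map_channelOutput {σ v : ℝ≥0} (hσ : σ ≠ 0) (hv : v ≠ 0) (a : Fin m) :
    (codebookLaw σ m F).map (channelOutput g a) =
      (codebookLaw v m F).withDensity fun p => ENNReal.ofReal (Real.exp (infoDensity g σ v a p)) := by
  -- The density is first found for a fixed codeword `x`, then integrated over the codebook.
  have hfib (x : Fin F → ℂ) : (Measure.pi fun _ : Fin F => complexGaussian σ).map
      (fun z f => x f + z f) = (Measure.pi fun _ => complexGaussian v).withDensity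
        fun y => ∏ f, ENNReal.ofReal (shiftRatio σ v (x f) (y f)) := by
    rw [Measure.pi_map_pi (f := fun f z => x f + z) (fun _ => by fun_prop)]
    simp_rw [complexGaussian_map_const_add hσ hv]
    have (f : Fin F) : IsProbabilityMeasure ((complexGaussian v).withDensity
        fun y => ENNReal.ofReal (shiftRatio σ v (x f) y)) := by
      rw [← complexGaussian_map_const_add hσ hv]
      exact Measure.isProbabilityMeasure_map (by fun_prop)
    exact pi_withDensity (fun _ => complexGaussian v)
      (fun f y => ENNReal.ofReal (shiftRatio σ v (x f) y))
      fun f => by unfold shiftRatio; fun_prop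
  have hexp (p : (Fin m → Fin F → ℂ) × (Fin F → ℂ)) :
      ENNReal.ofReal (Real.exp (infoDensity g σ v a p)) =
        ∏ f, ENNReal.ofReal (shiftRatio σ v (g * p.1 a f) (p.2 f)) := by
    rw [← ENNReal.ofReal_prod_of_nonneg fun f _ => (shiftRatio_pos hσ hv _ _).le, infoDensity,
      Real.exp_sum]
    congr 1
    exact Finset.prod_congr rfl fun f _ => Real.exp_log (shiftRatio_pos hσ hv _ _)
  ext s hs
  rw [Measure.map_apply (by fun_prop) hs, withDensity_apply _ hs, ← lintegral_indicator hs,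
    codebookLaw, codebookLaw, Measure.prod_apply (hs.preimage (by fun_prop)),
    lintegral_prod _ (Measurable.aemeasurable (Measurable.indicator (by fun_prop) hs))]
  refine lintegral_congr fun c => ?_
  have hsc : MeasurableSet (Prod.mk c ⁻¹' s) := measurable_prodMk_left hs
  have h1 := congrArg (fun μ => μ (Prod.mk c ⁻¹' s)) (hfib fun f => g * c a f)
  rw [Measure.map_apply (by fun_prop) hsc, withDensity_apply _ hsc, ← lintegral_indicator hsc] at h1
  refine Eq.trans ?_ (h1.trans (lintegral_congr fun y => ?_))
  · rfl
  · by_cases hy : (c, y) ∈ s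
    · rw [Set.indicator_of_mem hy, Set.indicator_of_mem (s := Prod.mk c ⁻¹' s) hy, hexp]
    · rw [Set.indicator_of_notMem hy, Set.indicator_of_notMem (s := Prod.mk c ⁻¹' s) hy]

/-- The probability that the normalized information density of `F` channel uses deviates from its
mean by at least `δ`. -/
noncomputable def atypicalProb (F : ℕ) (δ : ℝ) : ℝ≥0∞ :=
  (Measure.pi fun _ : Fin F => (complexGaussian 1).prod (complexGaussian σ))
    {x | δ ≤ |(∑ f, Real.log (shiftRatio σ v (g * (x f).1) (g * (x f).1 + (x f).2))) / F -
      Real.log (v / σ)|}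

variable {g σ v}

/-- Under the channel law the output has mean square `v` and the noise has mean square `σ`, so the
two normalized squares in the logarithm have equal means and only the constant remains. -/
lemma integral_log_shiftRatio (hσ : σ ≠ 0) (hv : (v : ℝ) = ‖g‖ ^ 2 + σ) :
    Integrable (fun x : ℂ × ℂ => Real.log (shiftRatio σ v (g * x.1) (g * x.1 + x.2)))
      ((complexGaussian 1).prod (complexGaussian σ)) ∧
    ∫ x : ℂ × ℂ, Real.log (shiftRatio σ v (g * x.1) (g * x.1 + x.2))
      ∂(complexGaussian 1).prod (complexGaussian σ) = Real.log (v / σ) := by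
  have hσ' : (0 : ℝ) < σ := by positivity
  have hv' : (0 : ℝ) < v := by rw [hv]; positivity
  have hv0 : v ≠ 0 := by exact_mod_cast hv'.ne'
  simp_rw [log_shiftRatio hσ hv0, add_sub_cancel_left]
  have hY := complexGaussian_norm_sq v
  rw [← complexGaussian_map_mul_add g σ v hv] at hY
  have iY : Integrable (fun x : ℂ × ℂ => ‖g * x.1 + x.2‖ ^ 2)
      ((complexGaussian 1).prod (complexGaussian σ)) := hY.1.comp_measurable (by fun_prop)
  have eY : ∫ x : ℂ × ℂ, ‖g * x.1 + x.2‖ ^ 2 ∂(complexGaussian 1).prod (complexGaussian σ) = v := by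
    rw [← hY.2, integral_map (by fun_prop) (by fun_prop)]
  have iZ : Integrable (fun x : ℂ × ℂ => ‖x.2‖ ^ 2)
      ((complexGaussian 1).prod (complexGaussian σ)) := (complexGaussian_norm_sq σ).1.comp_snd _
  have eZ : ∫ x : ℂ × ℂ, ‖x.2‖ ^ 2 ∂(complexGaussian 1).prod (complexGaussian σ) = σ := by
    rw [integral_fun_snd (fun z : ℂ => ‖z‖ ^ 2), (complexGaussian_norm_sq σ).2]
    simp
  have i1 : Integrable (fun x : ℂ × ℂ => Real.log (v / σ) + ‖g * x.1 + x.2‖ ^ 2 / v)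
      ((complexGaussian 1).prod (complexGaussian σ)) :=
    (integrable_const _).add (iY.div_const v)
  refine ⟨i1.sub (iZ.div_const σ), ?_⟩
  rw [integral_sub i1 (iZ.div_const σ), integral_add (integrable_const _) (iY.div_const v),
    integral_div, integral_div, eY, eZ, integral_const]
  simp [hσ'.ne', hv'.ne']

lemma tendsto_atypicalProb (hσ : σ ≠ 0) (hv : (v : ℝ) = ‖g‖ ^ 2 + σ) {δ : ℝ} (hδ : 0 < δ) :
    Tendsto (fun F => atypicalProb g σ v F δ) atTop (𝓝 0) := by
  obtain ⟨hi, he⟩ := integral_log_shiftRatio hσ hv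
  have := tendsto_pi_average_deviation _ (by unfold shiftRatio; fun_prop) hi hδ
  rw [he] at this
  exact this

lemma codebookLaw_atypical (a : Fin m) (δ : ℝ) :
    codebookLaw σ m F {p | δ ≤ |infoDensity g σ v a (channelOutput g a p) / F -
      Real.log (v / σ)|} = atypicalProb g σ v F δ := by
  have h1 : MeasurePreserving
      (Prod.map (Function.eval a) id : (Fin m → Fin F → ℂ) × (Fin F → ℂ) → _)
      (codebookLaw σ m F) ((Measure.pi fun _ => complexGaussian 1).prod
        (Measure.pi fun _ => complexGaussian σ)) :=
    (measurePreserving_eval (fun _ : Fin m => Measure.pi fun _ : Fin F => complexGaussian 1) a).prod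
      (MeasurePreserving.id _)
  have h2 := (measurePreserving_arrowProdEquivProdArrow ℂ ℂ (Fin F) (fun _ => complexGaussian 1)
    (fun _ => complexGaussian σ)).symm
  have h3 := h2.comp h1
  rw [atypicalProb, ← h3.measure_preimage (measurableSet_le (by fun_prop)
    (by unfold shiftRatio; fun_prop)).nullMeasurableSet]
  rfl

/-- Markov's inequality: the exponential of the information density is a probability density for
this law, hence has integral one. -/
lemma codebookLaw_infoDensity_gt {σ v : ℝ≥0} (hσ : σ ≠ 0) (hv : v ≠ 0) (a : Fin m) (t : ℝ) :
    codebookLaw v m F {p | t < infoDensity g σ v a p} ≤ ENNReal.ofReal (Real.exp (-t)) := by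
  have hms : MeasurableSet {p | t < infoDensity (F := F) g σ v a p} :=
    measurableSet_lt (by fun_prop) (by fun_prop)
  have h : ENNReal.ofReal (Real.exp t) * codebookLaw v m F {p | t < infoDensity g σ v a p} ≤ 1 := by
    have : IsProbabilityMeasure ((codebookLaw σ m F).map (channelOutput g a)) :=
      Measure.isProbabilityMeasure_map (by fun_prop)
    refine le_trans ?_ (prob_le_one (μ := (codebookLaw σ m F).map (channelOutput g a))
      (s := {p | t < infoDensity g σ v a p}))
    rw [codebookLaw_map_channelOutput g hσ hv, withDensity_apply _ hms, ← setLIntegral_const]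
    refine setLIntegral_mono' hms fun p hp => ENNReal.ofReal_le_ofReal (Real.exp_le_exp.mpr ?_)
    exact le_of_lt hp
  rw [Real.exp_neg, ENNReal.ofReal_inv_of_pos (Real.exp_pos t)]
  exact ENNReal.le_inv_iff_mul_le.mpr (by rwa [mul_comm])

/-- An unsent codeword is independent of the output, so it forms with the output the same pair law
as under `codebookLaw v`, where the Markov bound applies. -/
lemma codebookLaw_other_gt (hσ : σ ≠ 0) (hv : (v : ℝ) = ‖g‖ ^ 2 + σ) {a b : Fin m} (hab : b ≠ a)
    (t : ℝ) :
    codebookLaw σ m F {p | t < infoDensity g σ v b (channelOutput g a p)} ≤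
      ENNReal.ofReal (Real.exp (-t)) := by
  have hv' : (0 : ℝ) < v := by rw [hv]; positivity
  have hv0 : v ≠ 0 := by exact_mod_cast hv'.ne'
  refine le_of_eq_of_le ?_ (codebookLaw_infoDensity_gt (F := F) (g := g) hσ hv0 b t)
  set γ : Measure (Fin F → ℂ) := Measure.pi fun _ => complexGaussian 1
  set ζ : Measure (Fin F → ℂ) := Measure.pi fun _ => complexGaussian σ
  set η : Measure (Fin F → ℂ) := Measure.pi fun _ => complexGaussian v
  have hpair : MeasurePreserving (fun c : Fin m → Fin F → ℂ => (c b, c a))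
      (Measure.pi fun _ => γ) (γ.prod γ) := by
    refine ⟨by fun_prop, ?_⟩
    rw [← Measure.infinitePi_eq_pi, Measure.infinitePi_map_eval_prod hab]
  have hadd : MeasurePreserving (fun (p : (Fin F → ℂ) × (Fin F → ℂ)) f => g * p.1 f + p.2 f)
      (γ.prod ζ) η := ⟨by fun_prop, pi_complexGaussian_map_mul_add g σ v hv⟩
  have h1 : MeasurePreserving
      (fun p : (Fin m → Fin F → ℂ) × (Fin F → ℂ) => (p.1 b, fun f => g * p.1 a f + p.2 f))
      (codebookLaw σ m F) (γ.prod η) :=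
    ((MeasurePreserving.id γ).prod hadd).comp
      ((measurePreserving_prodAssoc γ γ ζ).comp (hpair.prod (MeasurePreserving.id ζ)))
  have h2 : MeasurePreserving
      (fun p : (Fin m → Fin F → ℂ) × (Fin F → ℂ) => (p.1 b, p.2))
      (codebookLaw v m F) (γ.prod η) :=
    (measurePreserving_eval (fun _ : Fin m => γ) b).prod (MeasurePreserving.id η)
  have hms : MeasurableSet {q : (Fin F → ℂ) × (Fin F → ℂ) |
      t < ∑ f, Real.log (shiftRatio σ v (g * q.1 f) (q.2 f))} :=
    measurableSet_lt (by fun_prop) (by unfold shiftRatio; fun_prop)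
  exact (h1.measure_preimage hms.nullMeasurableSet).trans
    (h2.measure_preimage hms.nullMeasurableSet).symm

/-- A threshold decoder for the Gaussian codebook. -/
lemma exists_decoder (hσ : σ ≠ 0) (hv : (v : ℝ) = ‖g‖ ^ 2 + σ) (hm : 0 < m) (hF : 0 < F) (δ : ℝ) :
    ∃ dec : (Fin m → Fin F → ℂ) × (Fin F → ℂ) → Fin m, Measurable dec ∧
      ∀ a, codebookLaw σ m F {p | dec (channelOutput g a p) ≠ a} ≤ atypicalProb g σ v F δ +
        m * ENNReal.ofReal (Real.exp (-(F * (Real.log (v / σ) - δ)))) := by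
  classical
  set t := F * (Real.log (v / σ) - δ)
  let A (p : (Fin m → Fin F → ℂ) × (Fin F → ℂ)) : Set (Fin m) := {a | t < infoDensity g σ v a p}
  have hA : Measurable A := measurable_set_iff.mpr fun a =>
    measurableSet_setOfPred.mp
      (measurableSet_lt measurable_const (measurable_infoDensity (F := F) g σ v a))
  -- The default value is immaterial: if no message or more than one passes the threshold, the
  -- outcome lies in the union bounded below.
  let sel (s : Set (Fin m)) : Fin m := if h : ∃ a, s = {a} then h.choose else ⟨0, hm⟩
  have hsel (a : Fin m) : sel {a} = a := by
    have h : ∃ b, ({a} : Set (Fin m)) = {b} := ⟨a, rfl⟩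
    simp only [sel, dif_pos h]
    exact (Set.singleton_injective h.choose_spec).symm
  refine ⟨fun p => sel (A p), (measurable_of_countable sel).comp hA, fun a => ?_⟩
  have hsub : {p : (Fin m → Fin F → ℂ) × (Fin F → ℂ) | sel (A (channelOutput g a p)) ≠ a} ⊆
      {p | δ ≤ |infoDensity g σ v a (channelOutput g a p) / F - Real.log (v / σ)|} ∪
      ⋃ b ∈ Finset.univ.erase a, {p | t < infoDensity g σ v b (channelOutput g a p)} := by
    intro p hp
    by_contra hcon
    simp only [Set.mem_union, Set.mem_ofPred_eq, Set.mem_iUnion, Finset.mem_erase, Finset.mem_univ,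
      and_true, exists_prop, not_or, not_exists, not_and, not_le, not_lt] at hcon
    apply hp
    have hAa : A (channelOutput g a p) = {a} := by
      ext b
      simp only [A, Set.mem_ofPred_eq, Set.mem_singleton_iff]
      constructor
      · intro hb
        by_contra hba
        exact absurd hb (not_lt.mpr (hcon.2 b hba))
      · rintro rfl
        have h1 := (abs_lt.mp hcon.1).1
        have hF' : (0 : ℝ) < F := by exact_mod_cast hF
        have h2 : Real.log (v / σ) - δ < infoDensity g σ v b (channelOutput g b p) / F := by
          linarith
        rwa [lt_div_iff₀ hF', mul_comm] at h2
    simp only [hAa, hsel]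
  refine (measure_mono hsub).trans ((measure_union_le _ _).trans ?_)
  rw [codebookLaw_atypical]
  refine add_le_add le_rfl ((measure_biUnion_finset_le _ _).trans ?_)
  refine (Finset.sum_le_card_nsmul _ _ (ENNReal.ofReal (Real.exp (-t))) fun b hb =>
    codebookLaw_other_gt hσ hv (Finset.ne_of_mem_erase hb) t).trans ?_
  rw [nsmul_eq_mul]
  gcongr
  exact (Finset.card_le_univ _).trans (by simp)

/-- A bound on the probability of correct decoding for every decoder. -/
lemma sum_correct_le (hσ : σ ≠ 0) (hv : (v : ℝ) = ‖g‖ ^ 2 + σ) (hF : 0 < F) (δ : ℝ)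
    {dec : (Fin m → Fin F → ℂ) × (Fin F → ℂ) → Fin m} (hdec : Measurable dec) :
    ∑ a, codebookLaw σ m F {p | dec (channelOutput g a p) = a} ≤ m * atypicalProb g σ v F δ +
      ENNReal.ofReal (Real.exp (F * (Real.log (v / σ) + δ))) := by
  have hv' : (0 : ℝ) < v := by rw [hv]; positivity
  have hv0 : v ≠ 0 := by exact_mod_cast hv'.ne'
  set t := F * (Real.log (v / σ) + δ)
  have hma (a : Fin m) : MeasurableSet {p | dec p = a} := hdec (measurableSet_singleton a)
  have hbound (a : Fin m) : codebookLaw σ m F {p | dec (channelOutput g a p) = a} ≤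
      atypicalProb g σ v F δ +
        ENNReal.ofReal (Real.exp t) * codebookLaw v m F {p | dec p = a} := by
    have hms : MeasurableSet ({p | dec p = a} ∩ {p | infoDensity g σ v a p ≤ t}) :=
      (hma a).inter (measurableSet_le (by fun_prop) (by fun_prop))
    -- Either the information density is atypical, or it is at most `t` and the change of measure
    -- costs at most `exp t`.
    have hsub : {p : (Fin m → Fin F → ℂ) × (Fin F → ℂ) | dec (channelOutput g a p) = a} ⊆
        {p | δ ≤ |infoDensity g σ v a (channelOutput g a p) / F - Real.log (v / σ)|} ∪
        channelOutput g a ⁻¹' ({p | dec p = a} ∩ {p | infoDensity g σ v a p ≤ t}) := by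
      intro p hp
      by_cases h : infoDensity g σ v a (channelOutput g a p) ≤ t
      · exact Or.inr ⟨hp, h⟩
      · left
        have hF' : (0 : ℝ) < F := by exact_mod_cast hF
        rw [not_le, show t = (Real.log (v / σ) + δ) * F from mul_comm _ _, ← lt_div_iff₀ hF'] at h
        have h' : δ ≤ infoDensity g σ v a (channelOutput g a p) / F - Real.log (v / σ) := by
          linarith
        exact h'.trans (le_abs_self _)
    refine (measure_mono hsub).trans ((measure_union_le _ _).trans ?_)
    rw [codebookLaw_atypical, ← Measure.map_apply (by fun_prop) hms,
      codebookLaw_map_channelOutput g hσ hv0, withDensity_apply _ hms]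
    refine add_le_add le_rfl ?_
    calc ∫⁻ p in {p | dec p = a} ∩ {p | infoDensity g σ v a p ≤ t},
          ENNReal.ofReal (Real.exp (infoDensity g σ v a p)) ∂codebookLaw v m F
        ≤ ∫⁻ _ in {p | dec p = a} ∩ {p | infoDensity g σ v a p ≤ t},
          ENNReal.ofReal (Real.exp t) ∂codebookLaw v m F :=
          setLIntegral_mono' hms fun p hp => ENNReal.ofReal_le_ofReal (Real.exp_le_exp.mpr hp.2)
      _ ≤ ENNReal.ofReal (Real.exp t) * codebookLaw v m F {p | dec p = a} := by
          rw [setLIntegral_const]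
          gcongr
          exact Set.inter_subset_left
  -- The reference law does not depend on `a` and the decoding regions partition the space; this is
  -- why the exponential term carries no factor `m`.
  have hone : ∑ a, codebookLaw v m F {p | dec p = a} = 1 := by
    have := sum_measure_preimage_singleton (μ := codebookLaw v m F) (f := dec) Finset.univ
      fun a _ => hma a
    simpa [Set.preimage] using this
  calc ∑ a, codebookLaw σ m F {p | dec (channelOutput g a p) = a}
      ≤ ∑ a : Fin m, (atypicalProb g σ v F δ +
        ENNReal.ofReal (Real.exp t) * codebookLaw v m F {p | dec p = a}) :=
        Finset.sum_le_sum fun a _ => hbound a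
    _ = _ := by
        rw [Finset.sum_add_distrib, ← Finset.mul_sum, hone, mul_one]
        simp

end GaussianCodebook

/-! ### Mutual information of the scalar Gaussian channel -/

section MutualInformation

lemma map_input_output_eq_withDensity (g : ℂ) {σ v : ℝ≥0} (hσ : σ ≠ 0) (hv : v ≠ 0) :
    ((complexGaussian 1).prod (complexGaussian σ)).map (fun p => (p.1, g * p.1 + p.2)) =
      ((complexGaussian 1).prod (complexGaussian v)).withDensity
        fun p => ENNReal.ofReal (shiftRatio σ v (g * p.1) p.2) := by
  have hm : Measurable fun p : ℂ × ℂ => ENNReal.ofReal (shiftRatio σ v (g * p.1) p.2) := by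
    unfold shiftRatio
    fun_prop
  ext s hs
  rw [Measure.map_apply (by fun_prop) hs, withDensity_apply _ hs, ← lintegral_indicator hs,
    Measure.prod_apply (hs.preimage (by fun_prop)),
    lintegral_prod _ (Measurable.aemeasurable (hm.indicator hs))]
  refine lintegral_congr fun x => ?_
  have hsx : MeasurableSet (Prod.mk x ⁻¹' s) := measurable_prodMk_left hs
  have h1 := congrArg (fun μ => μ (Prod.mk x ⁻¹' s)) (complexGaussian_map_const_add hσ hv (g * x))
  rw [Measure.map_apply (by fun_prop) hsx, withDensity_apply _ hsx, ← lintegral_indicator hsx] at h1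
  refine Eq.trans ?_ (h1.trans (lintegral_congr fun y => ?_))
  · rfl
  · by_cases hy : (x, y) ∈ s
    · rw [Set.indicator_of_mem hy, Set.indicator_of_mem (s := Prod.mk x ⁻¹' s) hy]
    · rw [Set.indicator_of_notMem hy, Set.indicator_of_notMem (s := Prod.mk x ⁻¹' s) hy]

/-- The mutual information, in nats, of the scalar complex Gaussian channel. -/
lemma klDiv_map_input_output {g : ℂ} {σ v : ℝ≥0} (hσ : σ ≠ 0) (hv : (v : ℝ) = ‖g‖ ^ 2 + σ) :
    InformationTheory.klDiv
      (((complexGaussian 1).prod (complexGaussian σ)).map (fun p => (p.1, g * p.1 + p.2)))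
      ((complexGaussian 1).prod (complexGaussian v)) = ENNReal.ofReal (Real.log (v / σ)) := by
  have hv' : (0 : ℝ) < v := by rw [hv]; positivity
  have hv0 : v ≠ 0 := by exact_mod_cast hv'.ne'
  set J := ((complexGaussian 1).prod (complexGaussian σ)).map (fun p => (p.1, g * p.1 + p.2)) with hJ
  set ν := (complexGaussian 1).prod (complexGaussian v)
  have : IsProbabilityMeasure J := Measure.isProbabilityMeasure_map (by fun_prop)
  have hJν : J = ν.withDensity fun p => ENNReal.ofReal (shiftRatio σ v (g * p.1) p.2) :=
    map_input_output_eq_withDensity g hσ hv0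
  have hac : J ≪ ν := by
    rw [hJν]
    exact withDensity_absolutelyContinuous _ _
  have hllr : llr J ν =ᵐ[J] fun p => Real.log (shiftRatio σ v (g * p.1) p.2) := by
    have h : J.rnDeriv ν =ᵐ[ν] fun p => ENNReal.ofReal (shiftRatio σ v (g * p.1) p.2) := by
      rw [hJν]
      exact Measure.rnDeriv_withDensity ν (by unfold shiftRatio; fun_prop)
    filter_upwards [hac.ae_le h] with p hp
    rw [llr, hp, ENNReal.toReal_ofReal (shiftRatio_pos hσ hv0 _ _).le]
  obtain ⟨hi, he⟩ := integral_log_shiftRatio hσ hv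
  have hm : Measurable fun p : ℂ × ℂ => Real.log (shiftRatio σ v (g * p.1) p.2) := by
    unfold shiftRatio
    fun_prop
  have hint : Integrable (llr J ν) J := by
    rw [integrable_congr hllr, hJ, integrable_map_measure hm.aestronglyMeasurable (by fun_prop)]
    exact hi
  rw [InformationTheory.klDiv_of_ac_of_integrable hac hint, integral_congr_ae hllr, hJ,
    integral_map (by fun_prop) hm.aestronglyMeasurable, he]
  simp [ν]

end MutualInformation

/-! ### Uniform messages -/

section UniformMessages

lemma uniformOn_univ_pi {ι : Type*} [Fintype ι] [DecidableEq ι] {α : ι → Type*}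
    [∀ i, Fintype (α i)] [∀ i, Nonempty (α i)] [∀ i, MeasurableSpace (α i)]
    [∀ i, MeasurableSingletonClass (α i)] :
    (uniformOn Set.univ : Measure (∀ i, α i)) = Measure.pi fun _ => uniformOn Set.univ := by
  refine Measure.ext_of_singleton fun x => ?_
  rw [Measure.pi_singleton]
  simp only [uniformOn_univ, Measure.count_singleton, Fintype.card_pi, one_div]
  rw [Nat.cast_prod, ENNReal.prod_inv_distrib]
  intro i _ j _ _
  simp

lemma measurePreserving_uniformOn_eval {S D : Type*} [Fintype S] [Fintype D] [DecidableEq S]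
    [DecidableEq D] {m : S → D → ℕ} (hm : ∀ s r, 0 < m s r) (s : S) (r : D) :
    MeasurePreserving (fun msg : ∀ s r, Fin (m s r) => msg s r)
      (uniformOn Set.univ) (uniformOn Set.univ) := by
  have (s : S) (r : D) : Nonempty (Fin (m s r)) := ⟨⟨0, hm s r⟩⟩
  rw [uniformOn_univ_pi]
  simp_rw [uniformOn_univ_pi (ι := D)]
  exact (measurePreserving_eval (fun r : D => (uniformOn Set.univ : Measure (Fin (m s r)))) r).comp
    (measurePreserving_eval (fun s : S => Measure.pi
      fun r : D => (uniformOn Set.univ : Measure (Fin (m s r)))) s)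

lemma lintegral_uniformOn_fin {m : ℕ} (e : Fin m → ℝ≥0∞) :
    ∫⁻ a, e a ∂uniformOn Set.univ = (∑ a, e a) / m := by
  rw [lintegral_fintype]
  simp [uniformOn_univ, ← Finset.sum_mul, div_eq_mul_inv]

end UniformMessages

/-! ### Reduction of the sub-channels to scalar channels -/

namespace OTFSSystem

variable {K Qh Qv M N : ℕ} {L : Fin K → ℕ} (P : OTFSSystem K Qh Qv M N L)

/-- The coefficient of the information symbol `u s' p` in the symbol received on the `r`-th
sub-channel of the `s`-th user terminal. -/
noncomputable def coeff (s : Fin K) (r : DDRE M N) (s' : Fin K) (p : DDRE M N) : ℂ :=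
  (Real.sqrt (P.ET / P.eta) : ℂ) * P.G s s' r p

/-- The coefficients of the interfering information symbols. -/
noncomputable def interference (s : Fin K) (r : DDRE M N) (s' : Fin K) (p : DDRE M N) : ℂ :=
  if s' = s ∧ p = r then 0 else P.coeff s r s' p

/-- The variance of interference and noise on a sub-channel. -/
noncomputable def noiseVar (s : Fin K) (r : DDRE M N) : ℝ≥0 :=
  ∑ s', ∑ p, ‖P.interference s r s' p‖₊ ^ 2 + P.N0.toNNReal

/-- The variance of the symbol received on a sub-channel. -/
noncomputable def outputVar (s : Fin K) (r : DDRE M N) : ℝ≥0 :=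
  ‖P.coeff s r s r‖₊ ^ 2 + P.noiseVar s r

lemma interference_self (s : Fin K) (r : DDRE M N) : P.interference s r s r = 0 := by
  simp [interference]

lemma coe_noiseVar (s : Fin K) (r : DDRE M N) : (P.noiseVar s r : ℝ) =
    ∑ s', ∑ p, ‖P.interference s r s' p‖ ^ 2 + P.N0.toNNReal := by
  simp [noiseVar]

lemma coe_outputVar (s : Fin K) (r : DDRE M N) : (P.outputVar s r : ℝ) =
    ‖P.coeff s r s r‖ ^ 2 + P.noiseVar s r := by
  simp [outputVar]

lemma noiseVar_ne_zero (s : Fin K) (r : DDRE M N) : P.noiseVar s r ≠ 0 := by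
  have : 0 < P.N0.toNNReal := Real.toNNReal_pos.mpr P.N0_pos
  unfold noiseVar
  positivity

/-- Every sub-channel is a scalar channel with additive interference and noise. -/
lemma receive_apply (s : Fin K) (u : Fin K → DDRE M N → ℂ) (w : DDRE M N → ℂ) (r : DDRE M N) :
    P.receive s u w r = P.coeff s r s r * u s r +
      (∑ s', ∑ p, P.interference s r s' p * u s' p + w r) := by
  have h1 : P.receive s u w r = ∑ s', ∑ p, P.coeff s r s' p * u s' p + w r := by
    have h (q : Fin (Qh * Qv)) : P.H q s *ᵥ P.precode q u =
        ((Real.sqrt (P.ET / P.eta) : ℝ) : ℂ) • ∑ s', (P.H q s * (P.H q s')ᴴ) *ᵥ u s' := by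
      rw [precode, Matrix.mulVec_smul, Matrix.mulVec_sum]
      simp_rw [Matrix.mulVec_mulVec]
    simp only [receive, h, ← Finset.smul_sum]
    rw [Finset.sum_comm]
    simp_rw [← Matrix.sum_mulVec]
    simp only [Pi.add_apply, Pi.smul_apply, Finset.sum_apply, smul_eq_mul, Matrix.mulVec,
      dotProduct, Finset.mul_sum, coeff, G, mul_assoc]
  have h2 (s' : Fin K) (p : DDRE M N) : P.coeff s r s' p * u s' p =
      (if s' = s then if p = r then P.coeff s r s r * u s r else 0 else 0) +
        P.interference s r s' p * u s' p := by
    rw [← ite_and, interference]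
    split_ifs with h
    · obtain ⟨rfl, rfl⟩ := h
      simp
    · simp
  rw [h1, Finset.sum_congr rfl fun s' _ => Finset.sum_congr rfl fun p _ => h2 s' p]
  simp only [Finset.sum_add_distrib, Finset.sum_ite_irrel, Finset.sum_const_zero,
    Finset.sum_ite_eq', Finset.mem_univ, if_true]
  ring

lemma eta_pos {P : OTFSSystem K Qh Qv M N L} (hQh : 0 < Qh) (hQv : 0 < Qv) (hM : 0 < M)
    (hN : 0 < N) (hL : ∀ s, 0 < L s) (s : Fin K) : 0 < P.eta := by
  have h : 0 < ∑ s, ∑ i, P.beta s i :=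
    Finset.sum_pos (fun s _ => Finset.sum_pos (fun i _ => P.beta_pos s i)
      ⟨⟨0, hL s⟩, Finset.mem_univ _⟩) ⟨s, Finset.mem_univ _⟩
  unfold eta
  positivity

/-- The precoder scales signal and interference powers by `ET / eta`. The same factor turns the term
`eta / (rho * M * N)` into `N0`, so it cancels from the ratio. -/
lemma outputVar_div_noiseVar (hM : 0 < M) (hN : 0 < N) (hη : 0 < P.eta) (s : Fin K)
    (r : DDRE M N) : (P.outputVar s r : ℝ) / P.noiseVar s r = 1 + P.sinr s r := by
  have hσ : (0 : ℝ) < P.noiseVar s r := by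
    have := P.noiseVar_ne_zero s r
    positivity
  have hE := P.ET_pos
  have hT := P.T_pos
  have hN0 := P.N0_pos
  have hnorm (s' : Fin K) (p : DDRE M N) :
      ‖P.coeff s r s' p‖ ^ 2 = P.ET / P.eta * ‖P.G s s' r p‖ ^ 2 := by
    rw [coeff, norm_mul, mul_pow, Complex.norm_real, Real.norm_eq_abs, sq_abs,
      Real.sq_sqrt (by positivity)]
  have hI : ∑ s', ∑ p, ‖P.interference s r s' p‖ ^ 2 = P.ET / P.eta *
      (∑ p ∈ Finset.univ.erase r, ‖P.G s s r p‖ ^ 2 +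
        ∑ s' ∈ Finset.univ.erase s, ∑ p, ‖P.G s s' r p‖ ^ 2) := by
    rw [← Finset.add_sum_erase _ _ (Finset.mem_univ s),
      ← Finset.add_sum_erase _ (fun p => ‖P.interference s r s p‖ ^ 2) (Finset.mem_univ r),
      interference_self, mul_add, Finset.mul_sum, Finset.mul_sum, norm_zero, zero_pow two_ne_zero,
      zero_add]
    congr 1
    · refine Finset.sum_congr rfl fun p hp => ?_
      rw [interference, if_neg (fun h => Finset.ne_of_mem_erase hp h.2), hnorm]
    · refine Finset.sum_congr rfl fun s' hs' => ?_
      rw [Finset.mul_sum]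
      refine Finset.sum_congr rfl fun p _ => ?_
      rw [interference, if_neg (fun h => Finset.ne_of_mem_erase hs' h.1), hnorm]
  have hn : (P.noiseVar s r : ℝ) = P.ET / P.eta * (P.eta / (P.rho * M * N) +
      ∑ p ∈ Finset.univ.erase r, ‖P.G s s r p‖ ^ 2 +
      ∑ s' ∈ Finset.univ.erase s, ∑ p, ‖P.G s s' r p‖ ^ 2) := by
    rw [coe_noiseVar, hI, Real.coe_toNNReal _ hN0.le, rho, deltaF]
    have hM' : (0 : ℝ) < M := by exact_mod_cast hM
    have hN' : (0 : ℝ) < N := by exact_mod_cast hN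
    have : P.ET / P.eta * (P.eta / (P.ET / (N * P.T) / (M * (1 / P.T) * P.N0) * M * N)) = P.N0 := by
      field_simp
    linear_combination -this
  rw [coe_outputVar, add_div, div_self hσ.ne', add_comm, hnorm, hn, sinr,
    mul_div_mul_left _ _ (by positivity)]

/-- The mutual information of a sub-channel. -/
lemma mutualInfoBits_subchannel (hM : 0 < M) (hN : 0 < N) (hη : 0 < P.eta) (s : Fin K)
    (r : DDRE M N) :
    mutualInfoBits P.frameLaw (fun ω => ω.1 s r) (fun ω => P.receive s ω.1 ω.2 r) =
      ENNReal.ofReal (Real.logb 2 (1 + P.sinr s r)) := by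
  set g := P.coeff s r s r
  have hlaw : MeasurePreserving (symbolAndNoise s r (P.interference s r)) P.frameLaw
      ((complexGaussian 1).prod (complexGaussian (P.noiseVar s r))) :=
    ⟨(symbolAndNoise s r (P.interference s r)).toContinuousLinearMap.continuous.measurable,
      map_symbolAndNoise (P.interference_self s r) _ _ (P.coe_noiseVar s r)⟩
  have hX : P.frameLaw.map (fun ω => ω.1 s r) = complexGaussian 1 :=
    (measurePreserving_fst.comp hlaw).map_eq
  have hYeq : (fun ω : (Fin K → DDRE M N → ℂ) × (DDRE M N → ℂ) => P.receive s ω.1 ω.2 r) =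
      (fun p : ℂ × ℂ => g * p.1 + p.2) ∘ symbolAndNoise s r (P.interference s r) := by
    ext ω
    rw [receive_apply]
    rfl
  have hXYeq : (fun ω : (Fin K → DDRE M N → ℂ) × (DDRE M N → ℂ) =>
      (ω.1 s r, P.receive s ω.1 ω.2 r)) =
      (fun p : ℂ × ℂ => (p.1, g * p.1 + p.2)) ∘ symbolAndNoise s r (P.interference s r) := by
    ext ω
    · rfl
    · rw [receive_apply]
      rfl
  rw [mutualInfoBits, hX, hYeq, hXYeq, ← Measure.map_map (by fun_prop) hlaw.measurable,
    ← Measure.map_map (by fun_prop) hlaw.measurable, hlaw.map_eq,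
    complexGaussian_map_mul_add _ _ _ (P.coe_outputVar s r),
    klDiv_map_input_output (P.noiseVar_ne_zero s r) (P.coe_outputVar s r),
    P.outputVar_div_noiseVar hM hN hη, Real.logb,
    ENNReal.ofReal_div_of_pos (Real.log_pos one_lt_two)]

/-! ### Achievability and converse for the sub-channels -/

section Coding

variable {F : ℕ} {m : Fin K → DDRE M N → ℕ}

lemma measurable_received (s : Fin K) (r : DDRE M N) (msg : Messages m) :
    Measurable fun p : Codebooks F m × (Fin F → DDRE M N → ℂ) =>
      P.received s r msg p.1 p.2 := by
  unfold received
  simp_rw [receive_apply]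
  fun_prop

/-- The error probability of a sub-channel is that of a scalar Gaussian channel, averaged over the
messages of this sub-channel. -/
lemma errorProb_eq (hm : ∀ s r, 0 < m s r) (s : Fin K) (r : DDRE M N)
    {dec : SubchannelDecoder F (m s r)} (hdec : Measurable dec) :
    P.errorProb s r F m dec = (∑ a, codebookLaw (P.noiseVar s r) (m s r) F
      {p | dec (channelOutput (P.coeff s r s r) a p) ≠ a}) / m s r := by
  have hfun : Measurable fun ω : Messages m × Codebooks F m × (Fin F → DDRE M N → ℂ) =>
      dec (ω.2.1 s r, P.received s r ω.1 ω.2.1 ω.2.2) := by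
    -- The message space is finite, so measurability may be checked for each fixed message tuple.
    refine measurable_from_prod_countable_right fun msg => hdec.comp ?_
    exact Measurable.prodMk (by fun_prop) (P.measurable_received s r msg)
  have hset : MeasurableSet {ω : Messages m × Codebooks F m × (Fin F → DDRE M N → ℂ) |
      dec (ω.2.1 s r, P.received s r ω.1 ω.2.1 ω.2.2) ≠ ω.1 s r} :=
    (measurableSet_eq_fun hfun (by fun_prop)).compl
  rw [errorProb, codingLaw, Measure.prod_apply hset, ← lintegral_uniformOn_fin,
    ← (measurePreserving_uniformOn_eval hm s r).lintegral_comp (measurable_of_countable _)]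
  refine lintegral_congr fun msg => ?_
  have hlaw : MeasurePreserving (codebookAndNoise (F := F) s r (P.interference s r) msg) _
      (codebookLaw (P.noiseVar s r) (m s r) F) :=
    ⟨(codebookAndNoise s r (P.interference s r) msg).toContinuousLinearMap.continuous.measurable,
      map_codebookAndNoise (P.interference_self s r) _ _ (P.coe_noiseVar s r) msg⟩
  have hms : MeasurableSet {p | dec (channelOutput (P.coeff s r s r) (msg s r) p) ≠ msg s r} :=
    (hdec.comp (by fun_prop) (measurableSet_singleton _)).compl
  rw [← hlaw.measure_preimage hms.nullMeasurableSet]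
  congr 1
  ext p
  have : (p.1 s r, P.received s r msg p.1 p.2) = channelOutput (P.coeff s r s r) (msg s r)
      (codebookAndNoise s r (P.interference s r) msg p) := by
    refine Prod.ext rfl (funext fun f => ?_)
    exact P.receive_apply s _ _ r
  change dec (p.1 s r, P.received s r msg p.1 p.2) ≠ msg s r ↔ _
  rw [this]
  rfl

/-- Rates that vanish or stay below the mutual information on every sub-channel are achievable. -/
lemma lcdAchievable_of_lt (hM : 0 < M) (hN : 0 < N) (hη : 0 < P.eta)
    {R : Fin K → DDRE M N → ℝ} (hR0 : ∀ s r, 0 ≤ R s r)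
    (hR : ∀ s r, R s r = 0 ∨ R s r < Real.logb 2 (1 + P.sinr s r)) : P.LCDAchievable R := by
  refine ⟨hR0, ?_⟩
  set m : ℕ → Fin K → DDRE M N → ℕ := fun F s r => ⌈(2 : ℝ) ^ ((F : ℝ) * R s r)⌉₊ with hmdef
  have hm (F : ℕ) (s r) : 0 < m F s r := Nat.ceil_pos.mpr (by positivity)
  have key (s : Fin K) (r : DDRE M N) : ∃ dec : ∀ F, SubchannelDecoder F (m F s r),
      (∀ F, Measurable (dec F)) ∧
        Tendsto (fun F => P.errorProb s r F (m F) (dec F)) atTop (𝓝 0) := by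
    rcases hR s r with h0 | hlt
    -- At rate zero there is a single message and no error is possible. This covers sub-channels
    -- whose mutual information is zero, where no positive gap is left.
    · refine ⟨fun F _ => ⟨0, hm F s r⟩, fun F => measurable_const, ?_⟩
      refine tendsto_const_nhds.congr fun F => ?_
      have hm1 : m F s r = 1 := by simp [hmdef, h0]
      have (ω : Messages (m F) × Codebooks F (m F) × (Fin F → DDRE M N → ℂ)) :
          (⟨0, hm F s r⟩ : Fin (m F s r)) = ω.1 s r := by
        ext
        have := (ω.1 s r).2
        simp only
        omega
      simp [errorProb, ← this]
    · have hl2 : 0 < Real.log 2 := Real.log_pos one_lt_two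
      set c := Real.log ((P.outputVar s r : ℝ) / P.noiseVar s r)
      have hRc : R s r * Real.log 2 < c := by
        rwa [Real.logb, ← P.outputVar_div_noiseVar hM hN hη, lt_div_iff₀ hl2] at hlt
      -- Half the gap: one `δ` lowers the threshold to allow for fluctuations, the other makes the
      -- union bound decay.
      set δ := (c - R s r * Real.log 2) / 2 with hδdef
      have hδ : 0 < δ := by
        rw [hδdef]
        linarith
      have hex (F : ℕ) : ∃ dec : SubchannelDecoder F (m F s r), Measurable dec ∧ (0 < F →
          ∀ a, codebookLaw (P.noiseVar s r) (m F s r) F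
            {p | dec (channelOutput (P.coeff s r s r) a p) ≠ a} ≤
            atypicalProb (P.coeff s r s r) (P.noiseVar s r) (P.outputVar s r) F δ +
              (m F s r) * ENNReal.ofReal (Real.exp (-(F * (c - δ))))) := by
        rcases Nat.eq_zero_or_pos F with rfl | hF
        · exact ⟨fun _ => ⟨0, hm 0 s r⟩, measurable_const, fun h => absurd h (lt_irrefl 0)⟩
        · obtain ⟨dec, h1, h2⟩ := exists_decoder (P.noiseVar_ne_zero s r) (P.coe_outputVar s r)
            (hm F s r) hF δ
          exact ⟨dec, h1, fun _ => h2⟩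
      choose dec hdec hbound using hex
      refine ⟨dec, hdec, ?_⟩
      have hexp : Tendsto (fun F : ℕ => ENNReal.ofReal (2 * Real.exp (-(F * δ)))) atTop (𝓝 0) := by
        rw [← ENNReal.ofReal_zero]
        refine ENNReal.tendsto_ofReal ?_
        rw [← mul_zero (2 : ℝ)]
        exact (Real.tendsto_exp_neg_atTop_nhds_zero.comp
          (tendsto_natCast_atTop_atTop.atTop_mul_const hδ)).const_mul 2
      have hlim := (tendsto_atypicalProb (P.noiseVar_ne_zero s r) (P.coe_outputVar s r) hδ).add hexp
      rw [add_zero] at hlim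
      refine tendsto_of_tendsto_of_tendsto_of_le_of_le' tendsto_const_nhds hlim
        (Eventually.of_forall fun _ => zero_le) ?_
      filter_upwards [eventually_gt_atTop 0] with F hF
      have hm0 : ((m F s r : ℕ) : ℝ≥0∞) ≠ 0 := by exact_mod_cast (hm F s r).ne'
      have hcount : (m F s r) * ENNReal.ofReal (Real.exp (-(F * (c - δ)))) ≤
          ENNReal.ofReal (2 * Real.exp (-(F * δ))) := by
        rw [← ENNReal.ofReal_natCast, ← ENNReal.ofReal_mul (by positivity)]
        refine ENNReal.ofReal_le_ofReal ?_
        -- Rounding up a number that is at least one at most doubles it; this is the source of the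
        -- factor `2`.
        have h1 : (1 : ℝ) ≤ 2 ^ ((F : ℝ) * R s r) :=
          Real.one_le_rpow one_le_two (mul_nonneg (Nat.cast_nonneg _) (hR0 s r))
        have h2 : (m F s r : ℝ) ≤ 2 * Real.exp (F * (R s r * Real.log 2)) := by
          have := (Nat.ceil_lt_add_one (zero_le_one.trans h1)).le
          have h3 : (2 : ℝ) ^ ((F : ℝ) * R s r) = Real.exp (F * (R s r * Real.log 2)) := by
            rw [Real.rpow_def_of_pos two_pos]
            congr 1
            ring
          rw [← h3]
          simp only [hmdef]
          linarith
        calc (m F s r : ℝ) * Real.exp (-(F * (c - δ)))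
            ≤ 2 * Real.exp (F * (R s r * Real.log 2)) * Real.exp (-(F * (c - δ))) := by gcongr
          _ = 2 * Real.exp (-(F * δ)) := by
            rw [mul_assoc, ← Real.exp_add]
            congr 2
            rw [hδdef]
            ring
      rw [P.errorProb_eq (hm F) s r (hdec F)]
      refine ENNReal.div_le_of_le_mul ((Finset.sum_le_card_nsmul _ _ _ fun a _ =>
        (hbound F hF a).trans (add_le_add le_rfl hcount)).trans ?_)
      rw [Finset.card_univ, Fintype.card_fin, nsmul_eq_mul, mul_comm]
  choose dec hdec hlim using key
  exact ⟨m, fun F s r => dec s r F, fun F s r => Nat.le_ceil _, fun F s r => hdec s r F, hlim⟩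

/-- Achievable rates do not exceed the mutual information of any sub-channel. -/
lemma LCDAchievable.le_logb {P : OTFSSystem K Qh Qv M N L} (hM : 0 < M) (hN : 0 < N)
    (hη : 0 < P.eta) {R : Fin K → DDRE M N → ℝ} (hR : P.LCDAchievable R) (s : Fin K)
    (r : DDRE M N) : R s r ≤ Real.logb 2 (1 + P.sinr s r) := by
  obtain ⟨hR0, m, dec, hmR, hdec, hlim⟩ := hR
  have hm (F : ℕ) (s r) : 0 < m F s r := by
    have : (0 : ℝ) < m F s r := lt_of_lt_of_le (by positivity) (hmR F s r)
    exact_mod_cast this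
  by_contra! hlt
  have hl2 : 0 < Real.log 2 := Real.log_pos one_lt_two
  set c := Real.log ((P.outputVar s r : ℝ) / P.noiseVar s r)
  have hRc : c < R s r * Real.log 2 := by
    rwa [Real.logb, ← P.outputVar_div_noiseVar hM hN hη, div_lt_iff₀ hl2] at hlt
  -- Then `c + 2 * δ` is the rate in nats, so `exp (F * (c + δ))` is at most `exp (-(F * δ))` times
  -- the number of messages.
  set δ := (R s r * Real.log 2 - c) / 2 with hδdef
  have hδ : 0 < δ := by
    rw [hδdef]
    linarith
  have hexp : Tendsto (fun F : ℕ => ENNReal.ofReal (Real.exp (-(F * δ)))) atTop (𝓝 0) := by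
    rw [← ENNReal.ofReal_zero]
    exact ENNReal.tendsto_ofReal (Real.tendsto_exp_neg_atTop_nhds_zero.comp
      (tendsto_natCast_atTop_atTop.atTop_mul_const hδ))
  -- Correct and wrong decoding have total probability one, yet the three terms that bound this
  -- total all tend to zero.
  have hsum := ((tendsto_atypicalProb (P.noiseVar_ne_zero s r) (P.coe_outputVar s r) hδ).add
    hexp).add (hlim s r)
  rw [add_zero, add_zero] at hsum
  refine absurd (ge_of_tendsto hsum (b := 1) ?_) (by simp)
  filter_upwards [eventually_gt_atTop 0] with F hF
  have hm0 : ((m F s r : ℕ) : ℝ≥0∞) ≠ 0 := by exact_mod_cast (hm F s r).ne'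
  have hmt : ((m F s r : ℕ) : ℝ≥0∞) ≠ ⊤ := ENNReal.natCast_ne_top _
  set μ := codebookLaw (P.noiseVar s r) (m F s r) F
  set g := P.coeff s r s r
  have hms (a : Fin (m F s r)) : MeasurableSet {p | dec F s r (channelOutput g a p) = a} :=
    (hdec F s r).comp (by fun_prop) (measurableSet_singleton _)
  have htot : ((m F s r : ℕ) : ℝ≥0∞) = ∑ a, μ {p | dec F s r (channelOutput g a p) = a} +
      ∑ a, μ {p | dec F s r (channelOutput g a p) ≠ a} := by
    have h1 (a : Fin (m F s r)) : μ {p | dec F s r (channelOutput g a p) = a} +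
        μ {p | dec F s r (channelOutput g a p) ≠ a} = 1 := prob_add_prob_compl (hms a)
    simp [← Finset.sum_add_distrib, h1]
  have hcorrect := sum_correct_le (P.noiseVar_ne_zero s r) (P.coe_outputVar s r) hF δ (hdec F s r)
  have hcount : ENNReal.ofReal (Real.exp (F * (c + δ))) ≤
      m F s r * ENNReal.ofReal (Real.exp (-(F * δ))) := by
    rw [← ENNReal.ofReal_natCast, ← ENNReal.ofReal_mul (by positivity)]
    refine ENNReal.ofReal_le_ofReal ?_
    have h3 : (2 : ℝ) ^ ((F : ℝ) * R s r) = Real.exp (F * (R s r * Real.log 2)) := by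
      rw [Real.rpow_def_of_pos two_pos]
      congr 1
      ring
    calc Real.exp (F * (c + δ))
        = Real.exp (F * (R s r * Real.log 2)) * Real.exp (-(F * δ)) := by
          rw [← Real.exp_add]
          congr 1
          rw [hδdef]
          ring
      _ ≤ m F s r * Real.exp (-(F * δ)) := by
          gcongr
          rw [← h3]
          exact hmR F s r
  rw [P.errorProb_eq (hm F) s r (hdec F s r)]
  refine (ENNReal.mul_le_mul_iff_right hm0 hmt).mp ?_
  rw [mul_one, mul_add, mul_add, ENNReal.mul_div_cancel hm0 hmt]
  conv_lhs => rw [htot]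
  exact add_le_add (hcorrect.trans (add_le_add le_rfl hcount)) le_rfl

end Coding

lemma tauMax_nonneg : 0 ≤ P.tauMax := by
  have := P.T_pos
  -- This includes the case without users, where the real supremum is `0` by convention.
  exact Real.iSup_nonneg fun p => by unfold tau; positivity

end OTFSSystem

/-! ### From sub-channel rates to spectral efficiencies -/

theorem theorem1 {K Qh Qv M N : ℕ} {L : Fin K → ℕ}
    (hQh : 0 < Qh) (hQv : 0 < Qv) (hM : 0 < M) (hN : 0 < N) (hL : ∀ s, 0 < L s)
    (P : OTFSSystem K Qh Qv M N L) :
    (∀ s r, mutualInfoBits P.frameLaw (fun ω => ω.1 s r) (fun ω => P.receive s ω.1 ω.2 r) =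
      ENNReal.ofReal (Real.logb 2 (1 + P.sinr s r))) ∧
    P.IsLCDSpectralEfficiency (fun s =>
      1 / (M * N * (1 + P.tauMax / (N * P.T))) * ∑ r, Real.logb 2 (1 + P.sinr s r)) := by
  have hM' : (0 : ℝ) < M := by exact_mod_cast hM
  have hN' : (0 : ℝ) < N := by exact_mod_cast hN
  have hT := P.T_pos
  have hτ := P.tauMax_nonneg
  have hη (s : Fin K) : 0 < P.eta := OTFSSystem.eta_pos hQh hQv hM hN hL s
  set B : ℝ := M * N * (1 + P.tauMax / (N * P.T)) with hB
  have hBpos : 0 < B := by positivity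
  have hSE (R : Fin K → DDRE M N → ℝ) (s : Fin K) :
      P.spectralEfficiency R s = 1 / B * ∑ r, R s r := by
    rw [OTFSSystem.spectralEfficiency, OTFSSystem.deltaF, hB]
    field_simp
    ring
  refine ⟨fun s r => P.mutualInfoBits_subchannel hM hN (hη s) s r, fun ε hε => ?_,
    fun R hR s => ?_⟩
  -- Positivity of `eta` requires a user; without users all claims are vacuous.
  · rcases Nat.eq_zero_or_pos K with rfl | hK
    · exact ⟨fun s => s.elim0, ⟨fun s => s.elim0, fun _ s => s.elim0, fun _ s => s.elim0,
        fun _ s => s.elim0, fun _ s => s.elim0, fun s => s.elim0⟩, fun s => s.elim0⟩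
    -- Every rate is lowered by `κ`. The total loss over the `M * N` sub-channels stays strictly
    -- below `ε * B`, thanks to the `+ 1`, and truncation at zero can only raise the sum.
    set κ : ℝ := ε * B / (M * N + 1) with hκ
    have hκpos : 0 < κ := by positivity
    refine ⟨fun s r => max 0 (Real.logb 2 (1 + P.sinr s r) - κ),
      P.lcdAchievable_of_lt hM hN (hη ⟨0, hK⟩) (fun s r => le_max_left _ _) fun s r => ?_,
      fun s => ?_⟩
    · rcases le_total (Real.logb 2 (1 + P.sinr s r) - κ) 0 with h | h
      · exact Or.inl (max_eq_left h)
      · right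
        rw [max_eq_right h]
        linarith
    · rw [hSE]
      beta_reduce
      have h1 : ∑ r, (Real.logb 2 (1 + P.sinr s r) - κ) ≤
          ∑ r, max 0 (Real.logb 2 (1 + P.sinr s r) - κ) :=
        Finset.sum_le_sum fun r _ => le_max_right _ _
      rw [Finset.sum_sub_distrib, Finset.sum_const, Finset.card_univ, Fintype.card_prod,
        Fintype.card_fin, Fintype.card_fin, nsmul_eq_mul, Nat.cast_mul] at h1
      have h2 : N * M * κ < ε * B := by
        rw [hκ, mul_div_assoc', div_lt_iff₀ (by positivity)]
        nlinarith [mul_pos hε hBpos]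
      rw [one_div_mul_eq_div, one_div_mul_eq_div, sub_lt_iff_lt_add, div_lt_iff₀ hBpos, add_mul,
        div_mul_cancel₀ _ hBpos.ne']
      linarith
  · rw [hSE]
    beta_reduce
    gcongr with r
    exact hR.le_logb hM hN (hη s) s r
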